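/- **Setting.** Let $N\ge 2$ be an integer and $s\in(1/2,1)$. For $0<\delta$, $x\in\mathbb R^N$, $|\xi|=1$ put $$\mathcal I_{\xi,\delta}\varphi(x)=C_s\,\mathrm{P.V.}\!\int_{-\delta}^{\delta}\frac{\varphi(x+\tau\xi)-\varphi(x)}{|\tau|^{1+2s}}\,d\tau,\qquad \mathcal I_{\xi}^{\delta}u(x)=C_s\int_{|\tau|\ge\delta}\frac{u(x+\tau\xi)-u(x)}{|\tau|^{1+2s}}\,d\tau,$$ where $C_s=\dfrac{s\,4^s\,\Gamma(s+\frac12)}{\sqrt\pi\,\Gamma(1-s)}$ is the normalizing constant of the one-dimensional fractional Laplacian, and $$\mathcal I_N^-(u,\varphi,x,\delta)=\inf\Big\{\sum_{i=1}^N\big(\mathcal I_{\xi_i,\delta}\varphi(x)+\mathcal I_{\xi_i}^{\delta}u(x)\big)\;:\;\{\xi_1,\dots,\xi_N\}\text{ an orthonormal basis of }\mathbb R^N\Big\}.$$ For $p\in\mathbb R$, a viscosity supersolution of $$\mathcal I_N^-u+u^p=0\quad\text{in }\mathbb R^N\qquad(\ast)$$ is a lower semicontinuous function $u:\mathbb R^N\to[0,\infty)$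 such that, for every $x\in\mathbb R^N$, every $\delta>0$ and every $\varphi$ of class $C^2$ on an open ball about $x$ of radius larger than $\delta$ for which $u-\varphi$ attains its minimum over $B_\delta(x)$ at $x$, one has $\mathcal I_N^-(u,\varphi,x,\delta)+u(x)^p\le 0$. Since $u\ge0$, the integrals $\mathcal I_\xi^\delta u(x)$ are well defined in $(-\infty,+\infty]$. (For $p\le 0$ we use the conventions $0^0=1$ and $0^p=0$ if $p<0$.) The supersolution is nontrivial if $u\not\equiv0$. Let $L^1_{2s}(\mathbb R^N)$ be the class of functions $u$ with $\int_{\mathbb R}\frac{|u(x+\tau\xi)|}{1+|\tau|^{1+2s}}\,d\tau<\infty$ for all $x\in\mathbb R^N$ and $|\xi|=1$. **Theorem (Liouville).** For $\gamma>0$ the integral $$c(\gamma)=\int_0^{+\infty}\frac{\big(1+\tau^2+\frac{2}{\sqrt N}\tau\big)^{-\gamma/2}+\big(1+\tau^2-\frac{2}{\sqrt N}\tau\big)^{-\gamma/2}-2}{\tau^{1+2s}}\,d\tau$$ converges absolutely, and there is a (necessarily unique) $\tilde\gamma=\tilde\gamma(N,s)>0$ with $c(\gamma)<0$ for $0<\gamma<\tilde\gamma$,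 $c(\tilde\gamma)=0$ and $c(\gamma)>0$ for $\gamma>\tilde\gamma$. For every $p\in\mathbb R$, equation $(\ast)$ has a nontrivial viscosity supersolution if and only if $$p>1+\frac{2s}{\tilde\gamma}.$$ The same equivalence holds if only supersolutions in $L^1_{2s}(\mathbb R^N)$ are considered. -/

import Mathlib

open scoped ENNReal Topology

noncomputable section

/-- The normalizing constant `C_s = C_{1,s}` of the fractional Laplacian on the real line,
`C_{1,s} = s 4^s Γ(s + 1/2) / (√π Γ(1 - s))`. -/
def normConst (s : ℝ) : ℝ :=
  s * 4 ^ s * Real.Gamma (s + 1 / 2) / (Real.sqrt Real.pi * Real.Gamma (1 - s))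

/-- The integral of `f` over `A` as an extended real number, `∫ f⁺ - ∫ f⁻`. It is used only for
integrands whose negative part is integrable, so it takes values in `(-∞, +∞]`. -/
def extIntegral (A : Set ℝ) (f : ℝ → ℝ) : EReal :=
  ((∫⁻ τ in A, ENNReal.ofReal (f τ) : ℝ≥0∞) : EReal) -
    ((∫⁻ τ in A, ENNReal.ofReal (-f τ) : ℝ≥0∞) : EReal)

/-- The inner part of the operator in the direction `ξ`,
`C_s PV ∫_{-δ}^{δ} [φ(x + τ ξ) - φ(x)] |τ|^{-(1 + 2s)} dτ`. -/
def innerOp {N : ℕ} (s δ : ℝ) (φ : EuclideanSpace ℝ (Fin N) → ℝ)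
    (x ξ : EuclideanSpace ℝ (Fin N)) : ℝ :=
  normConst s * Filter.limUnder (𝓝[>] (0 : ℝ)) (fun ε : ℝ =>
    ∫ τ in {τ : ℝ | ε ≤ |τ| ∧ |τ| < δ}, (φ (x + τ • ξ) - φ x) * |τ| ^ (-(1 + 2 * s)))

/-- The outer part of the operator in the direction `ξ`,
`C_s ∫_{(-δ, δ)ᶜ} [u(x + τ ξ) - u(x)] |τ|^{-(1 + 2s)} dτ`. -/
def outerOp {N : ℕ} (s δ : ℝ) (u : EuclideanSpace ℝ (Fin N) → ℝ)
    (x ξ : EuclideanSpace ℝ (Fin N)) : EReal :=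
  ((normConst s : ℝ) : EReal) *
    extIntegral {τ : ℝ | δ ≤ |τ|} (fun τ => (u (x + τ • ξ) - u x) * |τ| ^ (-(1 + 2 * s)))

/-- `𝓘_k^-(u, φ, x, δ)`: the infimum over all orthonormal `k`-frames `ξ` of
`∑ i, (𝓘_{ξ i, δ} φ(x) + 𝓘_{ξ i}^δ u(x))`. -/
def minimalOp {N : ℕ} (k : ℕ) (s δ : ℝ) (u φ : EuclideanSpace ℝ (Fin N) → ℝ)
    (x : EuclideanSpace ℝ (Fin N)) : EReal :=
  ⨅ ξ : {ξ : Fin k → EuclideanSpace ℝ (Fin N) // Orthonormal ℝ ξ},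
    ∑ i, (((innerOp s δ φ x (ξ.1 i) : ℝ) : EReal) + outerOp s δ u x (ξ.1 i))

/-- `u` is a (nonnegative, lower semicontinuous) viscosity supersolution of
`𝓘_k^- u + u^p = 0` in `ℝ^N`. The test function `φ` is of class `C²` near the closed ball of
radius `δ` about `x`, and touches `u` from below at `x` in that ball, up to an additive constant. -/
structure IsViscositySupersolution {N : ℕ} (k : ℕ) (s p : ℝ)
    (u : EuclideanSpace ℝ (Fin N) → ℝ) : Prop where
  nonneg : ∀ x, 0 ≤ u x
  lsc : LowerSemicontinuous u
  test : ∀ (x : EuclideanSpace ℝ (Fin N)) (δ ρ : ℝ) (φ : EuclideanSpace ℝ (Fin N) → ℝ),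
    0 < δ → δ < ρ → ContDiffOn ℝ 2 φ (Metric.ball x ρ) →
    IsMinOn (fun y => u y - φ y) (Metric.ball x δ) x →
    minimalOp k s δ u φ x + ((u x ^ p : ℝ) : EReal) ≤ 0

/-- The class `L^1_σ(ℝ^N)` of functions that are integrable, with the weight `1 / (1 + |τ|^{1 + σ})`,
along every line. -/
def LineIntegrable {N : ℕ} (σ : ℝ) (u : EuclideanSpace ℝ (Fin N) → ℝ) : Prop :=
  ∀ x ξ : EuclideanSpace ℝ (Fin N), ‖ξ‖ = 1 →
    MeasureTheory.Integrable (fun τ : ℝ => |u (x + τ • ξ)| / (1 + |τ| ^ (1 + σ)))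

/-- The integrand of `c(γ)`. -/
def critIntegrand (N : ℕ) (s γ τ : ℝ) : ℝ :=
  ((1 + τ ^ 2 + 2 / Real.sqrt N * τ) ^ (-γ / 2) +
    (1 + τ ^ 2 - 2 / Real.sqrt N * τ) ^ (-γ / 2) - 2) / τ ^ (1 + 2 * s)

/-- The function `c(γ)`, whose positive zero gives the critical exponent. -/
def critFun (N : ℕ) (s γ : ℝ) : ℝ :=
  ∫ τ in Set.Ioi (0 : ℝ), critIntegrand N s γ τ

end

open MeasureTheory Set Filter

/-! ### The even part of the binomial series -/

/-! On a line whose squared cosine with x is t < 1, the one-dimensional operator sends |x|^(-γ) to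
C_s |x|^(-γ-2s) times `profile s γ t`. The even part of the binomial series has nonnegative
coefficients, so the profile is convex and nondecreasing in t. The squared cosines of an orthonormal
basis sum to 1; by Jensen the sum over the basis is at least N times the profile at 1/N, which is
c(γ), and a basis at equal angles to x attains this. In γ, c is convex, vanishes at 0, first
decreases (because 1/N ≤ 1/2) and is eventually positive, whence the single sign change γ̃
(`exists_critical_exponent`). Replacing |x|² by L² + |x - z|² gives smooth functions for which the
same formula is exact, with smaller squared cosines (`integral_secondDiff_regPower`).

Existence: for γ = 2s/(p-1) < γ̃ a multiple of (1+|x|²)^(-γ/2) is a supersolution, since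
regularizing only lowers the profile (`exists_supersolution`).

Nonexistence: a nontrivial supersolution lies above a multiple of (1+|x|²)^(-γ̃/2)
(`exists_regPower_le`). Let q(L) be the largest multiple of (L²+|x|²)^(-γ̃/2) below u. If the
multiple a is almost optimal, up to a relative error ε at z, a bump of height of order ε produces a
touching point. There c(γ̃) = 0 leaves only the errors of the bump and of the regularization, so
that a^(p-1) ≤ C R^(γ̃(p-1)-2s) (ε + (L/R)²) with R² = L² + |z|²
(`exists_almost_touching_estimate`). Below the critical exponent, L → ∞ is contradictory. At it, q
is bounded; comparing two scales with almost equal q makes both ε and L/R small. -/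

theorem hasSum_one_sub_rpow_neg {q : ℝ} (hq : 0 < q) :
    ∃ c : ℕ → ℝ, (∀ n, 0 ≤ c n) ∧
      ∀ x : ℝ, |x| < 1 → HasSum (fun n => c n * x ^ n) ((1 - x) ^ (-q)) := by
  refine ⟨fun n => Ring.choose (q + n - 1) n, fun n => ?_, fun x hx => ?_⟩
  -- Up to the factor n!, the coefficient is the rising factorial q(q+1)⋯(q+n-1), which is positive.
  · have h := Ring.descPochhammer_eq_factorial_smul_choose (q + n - 1) n
    rw [Polynomial.descPochhammer_smeval_eq_ascPochhammer, Polynomial.ascPochhammer_smeval_eq_eval] at h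
    have h2 : q + n - 1 - n + 1 = q := by ring
    rw [h2, nsmul_eq_mul] at h
    have h3 := ascPochhammer_pos n q hq
    rw [h] at h3
    exact (pos_of_mul_pos_right h3 (by positivity)).le
  · have h := (Real.one_div_one_sub_rpow_hasFPowerSeriesOnBall_zero q).hasSum_sub (y := x)
      (by simpa [← ofReal_norm, Real.norm_eq_abs, enorm_eq_nnnorm, ← NNReal.coe_lt_coe] using hx)
    have h1 : (0 : ℝ) < 1 - x := by linarith [(abs_lt.1 hx).2]
    simpa [FormalMultilinearSeries.ofScalars_apply_eq, Real.rpow_neg h1.le, mul_comm] using h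

/-- The function `y ↦ (1 + √y)^(-q) + (1 - √y)^(-q)`. -/
noncomputable def evenBinomial (q y : ℝ) : ℝ := (1 + √y) ^ (-q) + (1 - √y) ^ (-q)

/-- Adding the series at √y and -√y cancels the odd powers and leaves integer powers of y with
nonnegative coefficients. Convexity and monotonicity in y then hold term by term. Odd indices carry
the coefficient 0, so the rounding in n / 2 is harmless. -/
theorem hasSum_evenBinomial {q : ℝ} (hq : 0 < q) :
    ∃ c : ℕ → ℝ, (∀ n, 0 ≤ c n) ∧
      ∀ y ∈ Ico (0 : ℝ) 1, HasSum (fun n => c n * y ^ (n / 2)) (evenBinomial q y) := by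
  obtain ⟨c, hc, h⟩ := hasSum_one_sub_rpow_neg hq
  refine ⟨fun n => if Even n then 2 * c n else 0, fun n => ?_, fun y hy => ?_⟩
  · dsimp only
    split_ifs
    · linarith [hc n]
    · exact le_rfl
  · have h1 : √y < 1 := by rw [Real.sqrt_lt' one_pos]; simpa using hy.2
    have h2 := Real.sqrt_nonneg y
    have h3 := (h (-√y) (by rw [abs_neg, abs_of_nonneg h2]; exact h1)).add
      (h (√y) (by rw [abs_of_nonneg h2]; exact h1))
    rw [sub_neg_eq_add] at h3
    refine h3.congr_fun ?_ |> fun h => h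
    intro n
    rcases Nat.even_or_odd n with hn | hn
    · obtain ⟨k, rfl⟩ := hn
      have e : (√y) ^ (k + k) = y ^ k := by rw [← two_mul, pow_mul, Real.sq_sqrt hy.1]
      have e2 : (k + k) / 2 = k := by omega
      simp [e, e2, (Even.add_self k).neg_pow]; ring
    · simp [Nat.not_even_iff_odd.2 hn, hn.neg_pow]

theorem convexOn_evenBinomial {q : ℝ} (hq : 0 < q) :
    ConvexOn ℝ (Ico (0 : ℝ) 1) (evenBinomial q) := by
  obtain ⟨c, hc, h⟩ := hasSum_evenBinomial hq
  refine ⟨convex_Ico 0 1, fun x hx y hy a b ha hb hab => ?_⟩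
  have hz := (convex_Ico (0 : ℝ) 1) hx hy ha hb hab
  refine hasSum_le (fun n => ?_) (h _ hz) (((h x hx).mul_left a).add ((h y hy).mul_left b))
  have := (convexOn_pow (𝕜 := ℝ) (n / 2)).2 (mem_Ici.2 hx.1) (mem_Ici.2 hy.1) ha hb hab
  simp only [smul_eq_mul] at this ⊢
  nlinarith [mul_le_mul_of_nonneg_left this (hc n)]

theorem monotoneOn_evenBinomial {q : ℝ} (hq : 0 < q) :
    MonotoneOn (evenBinomial q) (Ico (0 : ℝ) 1) := by
  obtain ⟨c, hc, h⟩ := hasSum_evenBinomial hq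
  exact fun x hx y hy hxy => hasSum_le
    (fun n => mul_le_mul_of_nonneg_left (pow_le_pow_left₀ hx.1 hxy _) (hc n)) (h x hx) (h y hy)

/-! ### The profile of a power along a line -/

/-- The integrand of `profile`. -/
noncomputable def profileIntegrand (s γ t τ : ℝ) : ℝ :=
  ((1 + τ ^ 2 + 2 * √t * τ) ^ (-γ / 2) + (1 + τ ^ 2 - 2 * √t * τ) ^ (-γ / 2) - 2) /
    τ ^ (1 + 2 * s)

/-- The value, up to scaling, of the one-dimensional fractional Laplacian of `|x|^(-γ)` in a
direction whose squared cosine with `x` is `t`. -/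
noncomputable def profile (s γ t : ℝ) : ℝ := ∫ τ in Ioi (0 : ℝ), profileIntegrand s γ t τ

theorem critIntegrand_eq (N : ℕ) (s γ τ : ℝ) :
    critIntegrand N s γ τ = profileIntegrand s γ (1 / N) τ := by
  simp [critIntegrand, profileIntegrand, div_eq_mul_inv]

theorem critFun_eq (N : ℕ) (s γ : ℝ) : critFun N s γ = profile s γ (1 / N) := by
  simp only [critFun, profile, critIntegrand_eq]

theorem base_minus_pos {t τ : ℝ} (ht : t ∈ Ico (0 : ℝ) 1) : 0 < 1 + τ ^ 2 - 2 * √t * τ := by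
  have h := Real.sq_sqrt ht.1
  nlinarith [sq_nonneg (τ - √t), ht.2]

theorem base_plus_pos {t τ : ℝ} (ht : t ∈ Ico (0 : ℝ) 1) : 0 < 1 + τ ^ 2 + 2 * √t * τ := by
  have h := Real.sq_sqrt ht.1
  nlinarith [sq_nonneg (τ + √t), ht.2]

theorem profile_ratio_mem {t τ : ℝ} (ht : t ∈ Ico (0 : ℝ) 1) :
    4 * τ ^ 2 / (1 + τ ^ 2) ^ 2 * t ∈ Icc 0 t := by
  have h1 : 4 * τ ^ 2 / (1 + τ ^ 2) ^ 2 ≤ 1 := by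
    rw [div_le_one (by positivity)]; nlinarith [sq_nonneg (1 - τ ^ 2)]
  exact ⟨mul_nonneg (by positivity) ht.1, mul_le_of_le_one_left ht.1 h1⟩

/-- With 1 + τ² factored out, the bases become 1 ± √y, where y is linear in t; convexity and
monotonicity in t are thereby inherited from `evenBinomial`. -/
theorem profile_numerator_eq {γ t τ : ℝ} (ht : t ∈ Ico (0 : ℝ) 1) (hτ : 0 ≤ τ) :
    (1 + τ ^ 2 + 2 * √t * τ) ^ (-γ / 2) + (1 + τ ^ 2 - 2 * √t * τ) ^ (-γ / 2) =
      (1 + τ ^ 2) ^ (-γ / 2) * evenBinomial (γ / 2) (4 * τ ^ 2 / (1 + τ ^ 2) ^ 2 * t) := by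
  have hA : 0 < 1 + τ ^ 2 := by positivity
  have hs : √(4 * τ ^ 2 / (1 + τ ^ 2) ^ 2 * t) = 2 * τ / (1 + τ ^ 2) * √t := by
    rw [Real.sqrt_mul (by positivity)]
    congr 1
    rw [Real.sqrt_eq_iff_mul_self_eq (by positivity) (by positivity)]
    field_simp; ring
  have hle : √(4 * τ ^ 2 / (1 + τ ^ 2) ^ 2 * t) ≤ 1 := by
    rw [Real.sqrt_le_one]
    exact (profile_ratio_mem ht).2.trans ht.2.le
  have h0 := Real.sqrt_nonneg (4 * τ ^ 2 / (1 + τ ^ 2) ^ 2 * t)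
  rw [evenBinomial, mul_add, ← neg_div, ← Real.mul_rpow hA.le (by linarith),
    ← Real.mul_rpow hA.le (by linarith), hs]
  congr 2 <;> field_simp

/-- An integrable function which dominates all profile integrands. -/
noncomputable def logWeight (s τ : ℝ) : ℝ := Real.log (1 + τ ^ 2) / τ ^ (1 + 2 * s)

theorem logWeight_nonneg {s τ : ℝ} (hτ : 0 ≤ τ) : 0 ≤ logWeight s τ :=
  div_nonneg (Real.log_nonneg (by nlinarith)) (Real.rpow_nonneg hτ _)

theorem measurable_logWeight (s : ℝ) : Measurable (logWeight s) := by
  unfold logWeight; fun_prop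

theorem measurable_profileIntegrand (s γ t : ℝ) : Measurable (profileIntegrand s γ t) := by
  unfold profileIntegrand; fun_prop

/-- Near 0, log(1+τ²) ≤ τ² leaves τ^(1-2s); at infinity the logarithm is at most a multiple of τ^s,
which leaves τ^(-1-s). -/
theorem integrableOn_logWeight {s : ℝ} (hs : s ∈ Ioo (0 : ℝ) 1) :
    IntegrableOn (logWeight s) (Ioi 0) := by
  rw [← Ioc_union_Ioi_eq_Ioi zero_le_one]
  refine IntegrableOn.union ?_ ?_
  · have h1 : IntegrableOn (fun τ : ℝ => τ ^ (1 - 2 * s)) (Ioc 0 1) :=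
      (intervalIntegrable_iff_integrableOn_Ioc_of_le zero_le_one).1
        (intervalIntegral.intervalIntegrable_rpow' (by linarith [hs.2]))
    refine h1.mono' (measurable_logWeight s).aestronglyMeasurable ?_
    filter_upwards [ae_restrict_mem measurableSet_Ioc] with τ hτ
    rw [Real.norm_of_nonneg (logWeight_nonneg hτ.1.le), logWeight,
      div_le_iff₀ (Real.rpow_pos_of_pos hτ.1 _), ← Real.rpow_add hτ.1]
    have : 1 - 2 * s + (1 + 2 * s) = (2 : ℕ) := by push_cast; ring
    rw [this, Real.rpow_natCast]
    linarith [Real.log_le_sub_one_of_pos (show 0 < 1 + τ ^ 2 by positivity)]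
  · have h1 : IntegrableOn (fun τ : ℝ => 2 ^ (s / 2) / (s / 2) * τ ^ (-1 - s)) (Ioi 1) :=
      (integrableOn_Ioi_rpow_of_lt (by linarith [hs.1]) one_pos).const_mul _
    refine h1.mono' (measurable_logWeight s).aestronglyMeasurable ?_
    filter_upwards [ae_restrict_mem measurableSet_Ioi] with τ hτ
    have hτ1 : (1 : ℝ) < τ := hτ
    have hτ0 : (0 : ℝ) < τ := by linarith
    rw [Real.norm_of_nonneg (logWeight_nonneg hτ0.le), logWeight,
      div_le_iff₀ (Real.rpow_pos_of_pos hτ0 _), mul_assoc, ← Real.rpow_add hτ0]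
    have h2 := Real.log_le_rpow_div (show 0 ≤ 1 + τ ^ 2 by positivity) (half_pos hs.1)
    have h3 : (1 + τ ^ 2) ^ (s / 2) ≤ (2 * τ ^ 2) ^ (s / 2) :=
      Real.rpow_le_rpow (by positivity) (by nlinarith) (by linarith [hs.1])
    rw [Real.mul_rpow (by norm_num) (by positivity), ← Real.rpow_natCast τ 2, ← Real.rpow_mul hτ0.le,
      Real.rpow_natCast] at h3
    have e1 : ((2 : ℕ) : ℝ) * (s / 2) = s := by push_cast; ring
    have e2 : -1 - s + (1 + 2 * s) = s := by ring
    rw [e1] at h3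
    rw [e2, div_mul_eq_mul_div]
    exact h2.trans (div_le_div_of_nonneg_right h3 (by linarith [hs.1]))

theorem one_sub_mul_log_le_rpow_neg {b q : ℝ} (hb : 0 < b) : 1 - q * Real.log b ≤ b ^ (-q) := by
  rw [Real.rpow_def_of_pos hb]
  linarith [Real.add_one_le_exp (Real.log b * -q)]

theorem log_base_add_le {t τ : ℝ} (ht : t ∈ Ico (0 : ℝ) 1) :
    Real.log (1 + τ ^ 2 + 2 * √t * τ) + Real.log (1 + τ ^ 2 - 2 * √t * τ) ≤
      2 * Real.log (1 + τ ^ 2) := by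
  rw [← Real.log_mul (base_plus_pos ht).ne' (base_minus_pos ht).ne']
  have : 2 * Real.log (1 + τ ^ 2) = Real.log ((1 + τ ^ 2) ^ 2) := by simp
  rw [this]
  refine Real.log_le_log (mul_pos (base_plus_pos ht) (base_minus_pos ht)) ?_
  nlinarith [sq_nonneg (√t * τ)]

/-- Both powers satisfy b^(-q) ≥ 1 - q log b, and the product of the two bases is at most (1+τ²)².
-/
theorem neg_mul_logWeight_le_profileIntegrand {s γ t τ : ℝ} (hγ : 0 ≤ γ)
    (ht : t ∈ Ico (0 : ℝ) 1) (hτ : 0 < τ) :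
    -(γ * logWeight s τ) ≤ profileIntegrand s γ t τ := by
  rw [logWeight, ← mul_div_assoc, ← neg_div, profileIntegrand]
  refine div_le_div_of_nonneg_right ?_ (Real.rpow_nonneg hτ.le _)
  have h1 := one_sub_mul_log_le_rpow_neg (q := γ / 2) (base_plus_pos (τ := τ) ht)
  have h2 := one_sub_mul_log_le_rpow_neg (q := γ / 2) (base_minus_pos (τ := τ) ht)
  rw [← neg_div] at h1 h2
  nlinarith [log_base_add_le (τ := τ) ht]

/-- A convex function lies below its chord: on [0, t1] the excess of `evenBinomial` over its value 2
at 0 is at most linear in y, and y ≤ 4 log(1+τ²). The endpoint t1 lies strictly between t and 1, so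
it is positive even for t = 0. -/
theorem exists_profileIntegrand_le {s γ t : ℝ} (hγ : 0 < γ) (ht : t ∈ Ico (0 : ℝ) 1) :
    ∃ C, 0 ≤ C ∧ ∀ τ, 0 < τ → profileIntegrand s γ t τ ≤ C * logWeight s τ := by
  have hq : 0 < γ / 2 := half_pos hγ
  set t1 := (1 + t) / 2 with ht1
  have ht1m : t1 ∈ Ico (0 : ℝ) 1 := ⟨by linarith [ht.1], by linarith [ht.2]⟩
  have ht1p : 0 < t1 := by linarith [ht.1]
  have h00 : evenBinomial (γ / 2) 0 = 2 := by simp [evenBinomial]; norm_num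
  have h2 : 2 ≤ evenBinomial (γ / 2) t1 :=
    h00.symm.le.trans (monotoneOn_evenBinomial hq ⟨le_rfl, one_pos⟩ ht1m ht1m.1)
  refine ⟨4 * (evenBinomial (γ / 2) t1 - 2) / t1, div_nonneg (by linarith) ht1p.le,
    fun τ hτ => ?_⟩
  rw [logWeight, ← mul_div_assoc, profileIntegrand, profile_numerator_eq ht hτ.le]
  refine div_le_div_of_nonneg_right ?_ (Real.rpow_nonneg hτ.le _)
  set y := 4 * τ ^ 2 / (1 + τ ^ 2) ^ 2 * t with hy
  have hym : y ∈ Icc 0 t := profile_ratio_mem ht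
  have hA : 0 < 1 + τ ^ 2 := by positivity
  have hyt1 : y ≤ t1 := hym.2.trans (by linarith [ht.2])
  have h3 : evenBinomial (γ / 2) ((1 - y / t1) • 0 + (y / t1) • t1) ≤ _ :=
    (convexOn_evenBinomial hq).2 (⟨le_rfl, one_pos⟩ : (0 : ℝ) ∈ Ico (0 : ℝ) 1) ht1m
      (sub_nonneg.2 ((div_le_one ht1p).2 hyt1)) (div_nonneg hym.1 ht1p.le) (by ring)
  simp only [smul_eq_mul, mul_zero, zero_add, div_mul_cancel₀ _ ht1p.ne', h00] at h3
  have h4 : (1 + τ ^ 2) ^ (-γ / 2) * evenBinomial (γ / 2) y ≤ evenBinomial (γ / 2) y := by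
    refine mul_le_of_le_one_left ?_ (Real.rpow_le_one_of_one_le_of_nonpos (by nlinarith)
      (by linarith))
    exact (by linarith : (0 : ℝ) ≤ 2).trans (h00.symm.le.trans
      (monotoneOn_evenBinomial hq ⟨le_rfl, one_pos⟩ ⟨hym.1, hyt1.trans_lt ht1m.2⟩ hym.1))
  have h5 : y ≤ 4 * Real.log (1 + τ ^ 2) := by
    have h6 := Real.one_sub_inv_le_log_of_pos hA
    have h7 : y ≤ 4 * (1 - (1 + τ ^ 2)⁻¹) := by
      have : 4 * (1 - (1 + τ ^ 2)⁻¹) = 4 * τ ^ 2 / (1 + τ ^ 2) := by field_simp; ring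
      rw [this, hy]
      refine (mul_le_of_le_one_right (by positivity) ht.2.le).trans ?_
      exact div_le_div_of_nonneg_left (by positivity) hA (by nlinarith)
    linarith
  have h6 : y / t1 * (evenBinomial (γ / 2) t1 - 2) ≤
      4 * Real.log (1 + τ ^ 2) / t1 * (evenBinomial (γ / 2) t1 - 2) :=
    mul_le_mul_of_nonneg_right (div_le_div_of_nonneg_right h5 ht1p.le) (by linarith)
  calc _ ≤ y / t1 * (evenBinomial (γ / 2) t1 - 2) := by nlinarith
    _ ≤ _ := h6
    _ = _ := by ring

theorem exists_norm_profileIntegrand_le {s γ t : ℝ} (hγ : 0 < γ) (ht : t ∈ Ico (0 : ℝ) 1) :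
    ∃ C, ∀ τ, 0 < τ → ‖profileIntegrand s γ t τ‖ ≤ C * logWeight s τ := by
  obtain ⟨C, hC, h⟩ := exists_profileIntegrand_le (s := s) hγ ht
  refine ⟨C + γ, fun τ hτ => abs_le.2 ⟨?_, ?_⟩⟩
  · nlinarith [neg_mul_logWeight_le_profileIntegrand (s := s) hγ.le ht hτ,
      logWeight_nonneg (s := s) hτ.le]
  · nlinarith [h τ hτ, logWeight_nonneg (s := s) hτ.le]

theorem integrableOn_profileIntegrand {s γ t : ℝ} (hs : s ∈ Ioo (0 : ℝ) 1) (hγ : 0 < γ)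
    (ht : t ∈ Ico (0 : ℝ) 1) : IntegrableOn (profileIntegrand s γ t) (Ioi 0) := by
  obtain ⟨C, h⟩ := exists_norm_profileIntegrand_le (s := s) hγ ht
  refine ((integrableOn_logWeight hs).const_mul C).mono'
    (measurable_profileIntegrand s γ t).aestronglyMeasurable ?_
  filter_upwards [ae_restrict_mem measurableSet_Ioi] with τ hτ using h τ hτ

theorem convexOn_profileIntegrand {s γ τ : ℝ} (hγ : 0 < γ) (hτ : 0 < τ) :
    ConvexOn ℝ (Ico (0 : ℝ) 1) (fun t => profileIntegrand s γ t τ) := by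
  refine ⟨convex_Ico 0 1, fun x hx y hy a b ha hb hab => ?_⟩
  have hz := (convex_Ico (0 : ℝ) 1) hx hy ha hb hab
  have hm : ∀ t ∈ Ico (0 : ℝ) 1, 4 * τ ^ 2 / (1 + τ ^ 2) ^ 2 * t ∈ Ico (0 : ℝ) 1 := fun t ht =>
    ⟨(profile_ratio_mem ht).1, (profile_ratio_mem ht).2.trans_lt ht.2⟩
  have h := (convexOn_evenBinomial (half_pos hγ)).2 (hm x hx) (hm y hy) ha hb hab
  simp only [smul_eq_mul] at h hz ⊢
  simp only [profileIntegrand, profile_numerator_eq hx hτ.le, profile_numerator_eq hy hτ.le,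
    profile_numerator_eq hz hτ.le]
  rw [← mul_div_assoc, ← mul_div_assoc, ← add_div]
  refine div_le_div_of_nonneg_right ?_ (Real.rpow_nonneg hτ.le _)
  have e : 4 * τ ^ 2 / (1 + τ ^ 2) ^ 2 * (a * x + b * y) =
    a * (4 * τ ^ 2 / (1 + τ ^ 2) ^ 2 * x) + b * (4 * τ ^ 2 / (1 + τ ^ 2) ^ 2 * y) := by ring
  rw [e]
  have := mul_le_mul_of_nonneg_left h
    (Real.rpow_nonneg (show 0 ≤ 1 + τ ^ 2 by positivity) (-γ / 2))
  have hb' : b = 1 - a := by linarith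
  subst hb'
  linarith

theorem profileIntegrand_mono {s γ τ t₁ t₂ : ℝ} (hγ : 0 < γ) (hτ : 0 < τ) (h1 : 0 ≤ t₁)
    (h12 : t₁ ≤ t₂) (h2 : t₂ < 1) : profileIntegrand s γ t₁ τ ≤ profileIntegrand s γ t₂ τ := by
  have ht1 : t₁ ∈ Ico (0 : ℝ) 1 := ⟨h1, h12.trans_lt h2⟩
  have ht2 : t₂ ∈ Ico (0 : ℝ) 1 := ⟨h1.trans h12, h2⟩
  have hm : ∀ t ∈ Ico (0 : ℝ) 1, 4 * τ ^ 2 / (1 + τ ^ 2) ^ 2 * t ∈ Ico (0 : ℝ) 1 := fun t ht =>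
    ⟨(profile_ratio_mem ht).1, (profile_ratio_mem ht).2.trans_lt ht.2⟩
  have h := monotoneOn_evenBinomial (half_pos hγ) (hm _ ht1) (hm _ ht2)
    (mul_le_mul_of_nonneg_left h12 (by positivity))
  simp only [profileIntegrand, profile_numerator_eq ht1 hτ.le, profile_numerator_eq ht2 hτ.le]
  exact div_le_div_of_nonneg_right (sub_le_sub_right (mul_le_mul_of_nonneg_left h
    (Real.rpow_nonneg (by positivity) _)) _) (Real.rpow_nonneg hτ.le _)

theorem profile_mono {s γ t₁ t₂ : ℝ} (hs : s ∈ Ioo (0 : ℝ) 1) (hγ : 0 < γ) (h1 : 0 ≤ t₁)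
    (h12 : t₁ ≤ t₂) (h2 : t₂ < 1) : profile s γ t₁ ≤ profile s γ t₂ :=
  setIntegral_mono_on (integrableOn_profileIntegrand hs hγ ⟨h1, h12.trans_lt h2⟩)
    (integrableOn_profileIntegrand hs hγ ⟨h1.trans h12, h2⟩) measurableSet_Ioi
    fun _ hτ => profileIntegrand_mono hγ hτ h1 h12 h2

theorem convexOn_profile {s γ : ℝ} (hs : s ∈ Ioo (0 : ℝ) 1) (hγ : 0 < γ) :
    ConvexOn ℝ (Ico (0 : ℝ) 1) (profile s γ) := by
  refine ⟨convex_Ico 0 1, fun x hx y hy a b ha hb hab => ?_⟩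
  have hz := (convex_Ico (0 : ℝ) 1) hx hy ha hb hab
  have hix := (integrableOn_profileIntegrand hs hγ hx).const_mul a
  have hiy := (integrableOn_profileIntegrand hs hγ hy).const_mul b
  simp only [profile, smul_eq_mul] at hz ⊢
  rw [← integral_const_mul, ← integral_const_mul, ← integral_add hix hiy]
  exact setIntegral_mono_on (integrableOn_profileIntegrand hs hγ hz) (hix.add hiy)
    measurableSet_Ioi fun τ hτ => (convexOn_profileIntegrand hγ hτ).2 hx hy ha hb hab

/-- Jensen's inequality for the profile. -/
theorem card_mul_profile_le_sum {N : ℕ} (hN : 0 < N) {s γ : ℝ} (hs : s ∈ Ioo (0 : ℝ) 1)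
    (hγ : 0 < γ) (t : Fin N → ℝ) (ht : ∀ i, t i ∈ Ico (0 : ℝ) 1) :
    N * profile s γ ((∑ i, t i) / N) ≤ ∑ i, profile s γ (t i) := by
  have hN' : (0 : ℝ) < N := by exact_mod_cast hN
  have h := (convexOn_profile hs hγ).map_sum_le (t := Finset.univ) (w := fun _ : Fin N => 1 / (N : ℝ))
    (p := t) (fun _ _ => by positivity) (by simp [hN'.ne']) (fun i _ => ht i)
  simp only [smul_eq_mul, ← Finset.mul_sum] at h
  rw [div_eq_inv_mul, ← one_div]
  calc _ ≤ N * (1 / N * ∑ i, profile s γ (t i)) := mul_le_mul_of_nonneg_left h hN'.le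
    _ = _ := by field_simp

/-- The profile is Lipschitz from the left at every point. -/
theorem exists_profile_sub_le {s γ t₀ : ℝ} (hs : s ∈ Ioo (0 : ℝ) 1) (hγ : 0 < γ)
    (ht : t₀ ∈ Ioo (0 : ℝ) 1) :
    ∃ C, 0 ≤ C ∧ ∀ t, 0 ≤ t → t ≤ t₀ → profile s γ t₀ - profile s γ t ≤ C * (t₀ - t) := by
  -- By convexity the slope from t₀ to any point t₂ on its right bounds every slope on its left.
  set t₂ := (1 + t₀) / 2 with ht2
  have h02 : t₀ < t₂ := by linarith [ht.2]
  have hm2 : t₂ ∈ Ico (0 : ℝ) 1 := ⟨by linarith [ht.1], by linarith [ht.2]⟩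
  refine ⟨(profile s γ t₂ - profile s γ t₀) / (t₂ - t₀), div_nonneg (sub_nonneg.2
    (profile_mono hs hγ ht.1.le h02.le hm2.2)) (by linarith), fun t h0 hle => ?_⟩
  rcases hle.eq_or_lt with rfl | hlt
  · simp
  · have := (convexOn_profile hs hγ).slope_mono_adjacent ⟨h0, hlt.trans ht.2⟩ hm2 hlt h02
    rwa [div_le_iff₀ (by linarith)] at this

/-! ### The critical exponent -/

theorem profileIntegrand_zero (s t τ : ℝ) : profileIntegrand s 0 t τ = 0 := by
  simp [profileIntegrand]; left; norm_num

theorem profile_zero (s t : ℝ) : profile s 0 t = 0 := by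
  simp [profile, profileIntegrand_zero]

theorem integrableOn_profileIntegrand_of_nonneg {s γ t : ℝ} (hs : s ∈ Ioo (0 : ℝ) 1) (hγ : 0 ≤ γ)
    (ht : t ∈ Ico (0 : ℝ) 1) : IntegrableOn (profileIntegrand s γ t) (Ioi 0) := by
  rcases hγ.eq_or_lt with rfl | h
  · rw [show profileIntegrand s 0 t = 0 from funext (profileIntegrand_zero s t)]
    exact integrableOn_zero
  · exact integrableOn_profileIntegrand hs h ht

theorem convexOn_rpow_exponent {b : ℝ} (hb : 0 < b) :
    ConvexOn ℝ univ (fun γ : ℝ => b ^ (-γ / 2)) := by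
  refine ⟨convex_univ, fun x _ y _ a c ha hc hac => ?_⟩
  have h := convexOn_exp.2 (mem_univ (Real.log b * (-x / 2))) (mem_univ (Real.log b * (-y / 2)))
    ha hc hac
  simp only [Real.rpow_def_of_pos hb]
  convert h using 2
  simp only [smul_eq_mul]; ring

theorem convexOn_profileIntegrand_exponent {s t τ : ℝ} (ht : t ∈ Ico (0 : ℝ) 1) (hτ : 0 < τ) :
    ConvexOn ℝ univ (fun γ => profileIntegrand s γ t τ) := by
  refine ⟨convex_univ, fun x hx y hy a b ha hb hab => ?_⟩
  have h1 := (convexOn_rpow_exponent (base_plus_pos (τ := τ) ht)).2 hx hy ha hb hab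
  have h2 := (convexOn_rpow_exponent (base_minus_pos (τ := τ) ht)).2 hx hy ha hb hab
  simp only [smul_eq_mul, profileIntegrand] at h1 h2 ⊢
  rw [← mul_div_assoc, ← mul_div_assoc, ← add_div]
  refine div_le_div_of_nonneg_right ?_ (Real.rpow_nonneg hτ.le _)
  have hb' : b = 1 - a := by linarith
  subst hb'
  linarith

theorem convexOn_profile_exponent {s t : ℝ} (hs : s ∈ Ioo (0 : ℝ) 1) (ht : t ∈ Ico (0 : ℝ) 1) :
    ConvexOn ℝ (Ici 0) (fun γ => profile s γ t) := by
  refine ⟨convex_Ici 0, fun x hx y hy a b ha hb hab => ?_⟩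
  have hz := (convex_Ici (0 : ℝ)) hx hy ha hb hab
  have hix := (integrableOn_profileIntegrand_of_nonneg hs hx ht).const_mul a
  have hiy := (integrableOn_profileIntegrand_of_nonneg hs hy ht).const_mul b
  simp only [profile, smul_eq_mul] at hz ⊢
  rw [← integral_const_mul, ← integral_const_mul, ← integral_add hix hiy]
  exact setIntegral_mono_on (integrableOn_profileIntegrand_of_nonneg hs hz ht) (hix.add hiy)
    measurableSet_Ioi fun τ hτ => (convexOn_profileIntegrand_exponent ht hτ).2 (mem_univ _)
      (mem_univ _) ha hb hab

/-- The right derivative at γ = 0 is minus the integral of half the logarithm of the product of the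
bases, and that product is 1 + 2τ²(1-2t) + τ⁴, which exceeds 1 because t ≤ 1/2. -/
theorem exists_profile_neg {s t : ℝ} (hs : s ∈ Ioo (0 : ℝ) 1) (ht : t ∈ Icc (0 : ℝ) (1 / 2)) :
    ∃ γ, 0 < γ ∧ profile s γ t < 0 := by
  have ht' : t ∈ Ico (0 : ℝ) 1 := ⟨ht.1, by linarith [ht.2]⟩
  set g : ℝ → ℝ := fun τ => (Real.log (1 + τ ^ 2 + 2 * √t * τ) +
    Real.log (1 + τ ^ 2 - 2 * √t * τ)) / 2 / τ ^ (1 + 2 * s) with hg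
  obtain ⟨C, hC, hle⟩ := exists_profileIntegrand_le (s := s) one_pos ht'
  have hlim : Tendsto (fun γ : ℝ => ∫ τ in Ioi (0 : ℝ), γ⁻¹ * profileIntegrand s γ t τ) (𝓝[>] 0)
      (𝓝 (∫ τ in Ioi (0 : ℝ), -g τ)) := by
    refine tendsto_integral_filter_of_dominated_convergence (fun τ => (1 + C) * logWeight s τ)
      (Eventually.of_forall fun γ =>
        ((measurable_profileIntegrand s γ t).const_mul _).aestronglyMeasurable) ?_
      ((integrableOn_logWeight hs).const_mul _) ?_
    · filter_upwards [Ioc_mem_nhdsGT (zero_lt_one' ℝ)] with γ hγ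
      filter_upwards [ae_restrict_mem measurableSet_Ioi] with τ hτ
      have hτ' : (0 : ℝ) < τ := hτ
      have hW := logWeight_nonneg (s := s) hτ'.le
      have h1 := neg_mul_logWeight_le_profileIntegrand (s := s) hγ.1.le ht' hτ'
      -- Convexity in γ bounds the difference quotient from above by its value at γ = 1, uniformly
      -- for γ in (0, 1].
      have h2 : profileIntegrand s ((1 - γ) • 0 + γ • 1) t τ ≤ _ :=
        (convexOn_profileIntegrand_exponent (s := s) ht' hτ').2 (mem_univ 0)
          (mem_univ 1) (sub_nonneg.2 hγ.2) hγ.1.le (by ring)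
      simp only [smul_eq_mul, mul_zero, zero_add, mul_one, profileIntegrand_zero] at h2
      have h3 := hle τ hτ'
      have h4 := mul_le_mul_of_nonneg_left h3 hγ.1.le
      rw [Real.norm_eq_abs, inv_mul_eq_div, abs_div, abs_of_pos hγ.1, div_le_iff₀ hγ.1, abs_le]
      have h5 := mul_nonneg hC (mul_nonneg hW hγ.1.le)
      constructor <;> nlinarith [mul_nonneg hW hγ.1.le]
    · filter_upwards [ae_restrict_mem measurableSet_Ioi] with τ hτ
      have hd : ∀ b : ℝ, 0 < b → HasDerivAt (fun γ : ℝ => b ^ (-γ / 2)) (-(Real.log b / 2)) 0 := by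
        intro b hb
        have h0 : HasDerivAt (fun γ : ℝ => -γ / 2) (-1 / 2) 0 :=
          ((hasDerivAt_id (0 : ℝ)).neg).div_const 2
        have := h0.const_rpow hb
        convert this using 1
        simp; ring
      have h1 := (((hd _ (base_plus_pos (τ := τ) ht')).add
        (hd _ (base_minus_pos (τ := τ) ht'))).sub_const 2).div_const (τ ^ (1 + 2 * s))
      have h2 := h1.tendsto_slope_zero.mono_left (nhdsGT_le_nhdsNE 0)
      have e : -g τ = (-(Real.log (1 + τ ^ 2 + 2 * √t * τ) / 2) +
        -(Real.log (1 + τ ^ 2 - 2 * √t * τ) / 2)) / τ ^ (1 + 2 * s) := by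
        simp only [hg]; ring
      rw [e]
      refine h2.congr fun γ => ?_
      simp only [zero_add, smul_eq_mul, Pi.add_apply]
      have h0 := profileIntegrand_zero s t τ
      simp only [profileIntegrand] at h0 ⊢
      rw [h0, sub_zero]
  have hgpos : ∀ τ ∈ Ioi (0 : ℝ), 0 < g τ := by
    intro τ hτ
    refine div_pos (half_pos ?_) (Real.rpow_pos_of_pos hτ _)
    rw [← Real.log_mul (base_plus_pos ht').ne' (base_minus_pos ht').ne']
    refine Real.log_pos ?_
    have h1 := Real.sq_sqrt ht.1
    have e : (1 + τ ^ 2 + 2 * √t * τ) * (1 + τ ^ 2 - 2 * √t * τ) =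
      1 + 2 * τ ^ 2 * (1 - 2 * t) + (τ ^ 2) ^ 2 := by linear_combination -4 * τ ^ 2 * h1
    rw [e]
    have h2 : 0 < (τ ^ 2) ^ 2 := by have : (0 : ℝ) < τ := hτ; positivity
    nlinarith [mul_nonneg (sq_nonneg τ) (show 0 ≤ 1 - 2 * t by linarith [ht.2])]
  have hgint : IntegrableOn g (Ioi 0) := by
    refine (integrableOn_logWeight hs).mono' (Measurable.aestronglyMeasurable (by
      simp only [hg]; fun_prop)) ?_
    filter_upwards [ae_restrict_mem measurableSet_Ioi] with τ hτ
    rw [Real.norm_of_nonneg (hgpos τ hτ).le, logWeight]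
    refine div_le_div_of_nonneg_right ?_ (Real.rpow_nonneg (le_of_lt hτ) _)
    linarith [log_base_add_le (τ := τ) ht']
  have hpos : 0 < ∫ τ in Ioi (0 : ℝ), g τ := by
    rw [setIntegral_pos_iff_support_of_nonneg_ae _ hgint]
    · have : Function.support g ∩ Ioi 0 = Ioi 0 :=
        inter_eq_right.2 fun τ hτ => (hgpos τ hτ).ne'
      simp [this]
    · filter_upwards [ae_restrict_mem measurableSet_Ioi] with τ hτ using (hgpos τ hτ).le
  rw [integral_neg] at hlim
  obtain ⟨γ, h1, h2⟩ := ((hlim.eventually (gt_mem_nhds (neg_neg_of_pos hpos))).and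
    self_mem_nhdsWithin).exists
  have h2' : (0 : ℝ) < γ := h2
  refine ⟨γ, h2, ?_⟩
  rw [integral_const_mul] at h1
  exact neg_of_mul_neg_right h1 (inv_nonneg.2 h2'.le)

/-- For τ in (√t/2, √t] the smaller base is below 1 by a fixed amount, and the quadratic term of the
exponential gains a multiple of γ² there. For large γ this beats the loss, at most linear in γ, from
the other τ. -/
theorem exists_profile_pos {s t : ℝ} (hs : s ∈ Ioo (0 : ℝ) 1) (ht : t ∈ Ioo (0 : ℝ) 1) :
    ∃ γ, 0 < γ ∧ 0 < profile s γ t := by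
  have ht' : t ∈ Ico (0 : ℝ) 1 := ⟨ht.1.le, ht.2⟩
  have hθ : 0 < √t := Real.sqrt_pos.2 ht.1
  have hθ2 : (√t) ^ 2 = t := Real.sq_sqrt ht.1.le
  have hθ1 : √t < 1 := by rw [Real.sqrt_lt' one_pos]; simpa using ht.2
  set W := ∫ τ in Ioi (0 : ℝ), logWeight s τ with hW
  have hW0 : 0 ≤ W := setIntegral_nonneg measurableSet_Ioi fun τ hτ => logWeight_nonneg (le_of_lt hτ)
  set E : Set ℝ := Ioc (√t / 2) (√t) with hE
  -- This is (1/2)(1/2)²(t/2)²: half the square of (γ/2)l, divided by γ², with l = -log(base) ≥ t/2.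
  set κ : ℝ := t ^ 2 / 32 with hκ
  have hκ0 : 0 < κ := by have := ht.1; positivity
  have key : ∀ γ, 0 < γ → -(γ * W) + γ ^ 2 * κ * (√t / 2) ≤ profile s γ t := by
    intro γ hγ
    have hi1 : IntegrableOn (fun τ => -(γ * logWeight s τ)) (Ioi 0) :=
      ((integrableOn_logWeight hs).const_mul γ).neg
    have hi2 : IntegrableOn (E.indicator fun _ => γ ^ 2 * κ) (Ioi 0) :=
      ((integrable_indicator_iff measurableSet_Ioc).2
        (integrableOn_const (by simp))).integrableOn
    have hEs : Ioi (0 : ℝ) ∩ E = E := inter_eq_right.2 fun τ hτ => (half_pos hθ).trans hτ.1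
    have e : -(γ * W) + γ ^ 2 * κ * (√t / 2) =
        ∫ τ in Ioi (0 : ℝ), (-(γ * logWeight s τ) + E.indicator (fun _ => γ ^ 2 * κ) τ) := by
      rw [integral_add hi1 hi2, integral_neg, integral_const_mul,
        setIntegral_indicator measurableSet_Ioc, hEs]
      have : volume.real E = √t / 2 := by
        simp [hE, measureReal_def, sub_half, (half_pos hθ).le]
      simp [this]; ring
    rw [e]
    refine setIntegral_mono_on (hi1.add hi2) (integrableOn_profileIntegrand hs hγ ht')
      measurableSet_Ioi fun τ hτ => ?_
    by_cases hτE : τ ∈ E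
    · rw [indicator_of_mem hτE]
      have hτ' : (0 : ℝ) < τ := hτ
      have hpow : τ ^ (1 + 2 * s) ≤ 1 :=
        Real.rpow_le_one hτ'.le (hτE.2.trans hθ1.le) (by linarith [hs.1])
      have hpow0 : 0 < τ ^ (1 + 2 * s) := Real.rpow_pos_of_pos hτ' _
      have hb := base_minus_pos (τ := τ) ht'
      have hlog : t / 2 ≤ -Real.log (1 + τ ^ 2 - 2 * √t * τ) := by
        have h1 := Real.log_le_sub_one_of_pos hb
        nlinarith [mul_nonneg (sub_nonneg.2 hτE.2) hτ'.le, mul_pos hθ (sub_pos.2 hτE.1)]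
      have h1 := one_sub_mul_log_le_rpow_neg (q := γ / 2) (base_plus_pos (τ := τ) ht')
      have h2 : 1 - γ / 2 * Real.log (1 + τ ^ 2 - 2 * √t * τ) + γ ^ 2 * κ ≤
          (1 + τ ^ 2 - 2 * √t * τ) ^ (-(γ / 2)) := by
        rw [Real.rpow_def_of_pos hb]
        set l := -Real.log (1 + τ ^ 2 - 2 * √t * τ) with hl
        have hl' : Real.log (1 + τ ^ 2 - 2 * √t * τ) = -l := by rw [hl, neg_neg]
        have hl0 : 0 ≤ l := le_trans (by linarith [ht.1]) hlog
        rw [hl', neg_mul_neg]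
        have h3 := Real.quadratic_le_exp_of_nonneg (mul_nonneg hl0 (half_pos hγ).le)
        have h4 : (t / 2) ^ 2 ≤ l ^ 2 := pow_le_pow_left₀ (by linarith [ht.1]) hlog 2
        have h5 := mul_le_mul_of_nonneg_left h4 (sq_nonneg γ)
        simp only [hκ]
        linarith
      rw [← neg_div] at h1 h2
      have h3 : γ ^ 2 * κ ≤ γ ^ 2 * κ / τ ^ (1 + 2 * s) :=
        le_div_self (by positivity) hpow0 hpow
      refine (add_le_add_right h3 _).trans ?_
      rw [logWeight, ← mul_div_assoc, ← neg_div, ← add_div, profileIntegrand]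
      refine div_le_div_of_nonneg_right ?_ hpow0.le
      nlinarith [log_base_add_le (τ := τ) ht']
    · rw [indicator_of_notMem hτE, add_zero]
      exact neg_mul_logWeight_le_profileIntegrand hγ.le ht' hτ
  have hden : 0 < κ * (√t / 2) := by positivity
  refine ⟨(W + 1) / (κ * (√t / 2)), by positivity, ?_⟩
  have hγ : 0 < (W + 1) / (κ * (√t / 2)) := by positivity
  refine lt_of_lt_of_le ?_ (key _ hγ)
  set γ := (W + 1) / (κ * (√t / 2)) with hγd
  have : γ * (κ * (√t / 2)) = W + 1 := by rw [hγd]; field_simp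
  have e : -(γ * W) + γ ^ 2 * κ * (√t / 2) = γ * (γ * (κ * (√t / 2)) - W) := by ring
  rw [e, this]
  linarith

theorem exists_critical_exponent {s t : ℝ} (hs : s ∈ Ioo (0 : ℝ) 1)
    (ht : t ∈ Ioc (0 : ℝ) (1 / 2)) :
    ∃ γt : ℝ, 0 < γt ∧ (∀ γ, 0 < γ → γ < γt → profile s γ t < 0) ∧ profile s γt t = 0 ∧
      ∀ γ, γt < γ → 0 < profile s γ t := by
  have ht' : t ∈ Ioo (0 : ℝ) 1 := ⟨ht.1, by linarith [ht.2]⟩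
  obtain ⟨a, ha, hca⟩ := exists_profile_neg hs ⟨ht.1.le, ht.2⟩
  obtain ⟨b, hb, hcb⟩ := exists_profile_pos hs ht'
  have hconv := convexOn_profile_exponent hs ⟨ht'.1.le, ht'.2⟩
  have hzero := profile_zero s t
  -- The one consequence of convexity in use: between two nonpositive values, one of them negative,
  -- the function is negative. Each sign statement is an instance of it.
  have hneg : ∀ x y z : ℝ, 0 ≤ x → x < y → y < z → profile s x t ≤ 0 → profile s z t ≤ 0 →
      profile s x t < 0 ∨ profile s z t < 0 → profile s y t < 0 := by
    intro x y z hx hxy hyz h1 h2 h3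
    have h := hconv.2 hx (hx.trans (hxy.trans hyz).le : (0 : ℝ) ≤ z)
      (div_nonneg (sub_nonneg.2 hyz.le) (sub_pos.2 (hxy.trans hyz)).le)
      (div_nonneg (sub_nonneg.2 hxy.le) (sub_pos.2 (hxy.trans hyz)).le)
      (by have := (sub_pos.2 (hxy.trans hyz)).ne'; field_simp; ring)
    have hd := sub_pos.2 (hxy.trans hyz)
    have e : ((z - y) / (z - x)) • x + ((y - x) / (z - x)) • z = y := by
      simp only [smul_eq_mul]; field_simp; ring
    rw [e] at h
    refine lt_of_le_of_lt h ?_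
    have p1 : 0 < (z - y) / (z - x) := div_pos (sub_pos.2 hyz) hd
    have p2 : 0 < (y - x) / (z - x) := div_pos (sub_pos.2 hxy) hd
    simp only [smul_eq_mul]
    rcases h3 with h3 | h3
    · linarith [mul_neg_of_pos_of_neg p1 h3, mul_nonpos_of_nonneg_of_nonpos p2.le h2]
    · linarith [mul_neg_of_pos_of_neg p2 h3, mul_nonpos_of_nonneg_of_nonpos p1.le h1]
  have hab : a < b := by
    by_contra hba
    rcases (not_lt.1 hba).eq_or_lt with rfl | hlt
    · linarith
    · linarith [hneg 0 b a le_rfl hb hlt hzero.le hca.le (Or.inr hca)]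
  have hcont : ContinuousOn (fun γ => profile s γ t) (Icc a b) :=
    ((hconv.subset Ioi_subset_Ici_self (convex_Ioi 0)).continuousOn isOpen_Ioi).mono
      fun x hx => lt_of_lt_of_le ha hx.1
  obtain ⟨c, hc, hc0⟩ := intermediate_value_Icc hab.le hcont
    (⟨hca.le, hcb.le⟩ : (0 : ℝ) ∈ Icc (profile s a t) (profile s b t))
  have hc0' : profile s c t = 0 := hc0
  have hac : a < c := lt_of_le_of_ne hc.1 (by rintro rfl; linarith)
  refine ⟨c, ha.trans hac, fun γ h1 h2 => ?_, hc0, fun γ h => ?_⟩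
  · rcases lt_trichotomy γ a with h | rfl | h
    · exact hneg 0 γ a le_rfl h1 h hzero.le hca.le (Or.inr hca)
    · exact hca
    · exact hneg a γ c ha.le h h2 hca.le hc0'.le (Or.inl hca)
  · by_contra hn
    linarith [hneg a c γ ha.le hac h hca.le (not_lt.1 hn) (Or.inl hca)]

/-! ### The operators as integrals of second differences -/

theorem normConst_pos {s : ℝ} (hs : s ∈ Ioo (0 : ℝ) 1) : 0 < normConst s := by
  have h1 : 0 < Real.Gamma (s + 1 / 2) := Real.Gamma_pos_of_pos (by linarith [hs.1])
  have h2 : 0 < Real.Gamma (1 - s) := Real.Gamma_pos_of_pos (by linarith [hs.2])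
  have := hs.1
  have := Real.pi_pos
  unfold normConst
  positivity

/-- Folding τ and -τ together turns the truncated inner integrals and the outer integral into
integrals of second differences over positive τ. -/
theorem setIntegral_abs_mem {S : Set ℝ} (hS : MeasurableSet S) (hS0 : S ⊆ Ioi 0) {H : ℝ → ℝ}
    (hH : IntegrableOn H {τ | |τ| ∈ S}) :
    IntegrableOn (fun τ => H τ + H (-τ)) S ∧
      ∫ τ in {τ | |τ| ∈ S}, H τ = ∫ τ in S, (H τ + H (-τ)) := by
  have hneg : MeasurableSet (-S) := hS.neg
  have hun : {τ : ℝ | |τ| ∈ S} = S ∪ -S := by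
    ext τ
    simp only [mem_ofPred_eq, mem_union, Set.mem_neg]
    rcases le_total 0 τ with h | h
    · rw [abs_of_nonneg h]
      refine ⟨Or.inl, fun h' => h'.elim id fun h2 => ?_⟩
      have : (0 : ℝ) < -τ := hS0 h2
      linarith
    · rw [abs_of_nonpos h]
      refine ⟨Or.inr, fun h' => h'.elim (fun h2 => ?_) id⟩
      have : (0 : ℝ) < τ := hS0 h2
      linarith
  have hdis : Disjoint S (-S) := by
    rw [Set.disjoint_left]
    intro τ h1 h2
    have a : (0 : ℝ) < τ := hS0 h1
    have b : (0 : ℝ) < -τ := hS0 h2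
    linarith
  rw [hun] at hH ⊢
  have h1 : IntegrableOn H S := hH.mono_set subset_union_left
  have h2 : IntegrableOn H (-S) := hH.mono_set subset_union_right
  have hmp := (Measure.measurePreserving_neg (volume : Measure ℝ))
  have hemb : MeasurableEmbedding (Neg.neg : ℝ → ℝ) := (Homeomorph.neg ℝ).measurableEmbedding
  have hpre : (Neg.neg : ℝ → ℝ) ⁻¹' (-S) = S := by ext; simp
  have h3 : IntegrableOn (fun τ => H (-τ)) S := by
    have := (hmp.integrableOn_comp_preimage hemb (f := H) (s := -S)).2 h2
    rwa [hpre] at this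
  refine ⟨h1.add h3, ?_⟩
  rw [setIntegral_union hdis hneg h1 h2, integral_add h1 h3]
  congr 1
  have := hmp.setIntegral_preimage_emb hemb H (-S)
  rw [hpre] at this
  exact this.symm

section

variable {N : ℕ}

/-- The weighted second difference of `f` at `x` in the direction `ξ`. -/
noncomputable def secondDiff (s : ℝ) (f : EuclideanSpace ℝ (Fin N) → ℝ)
    (x ξ : EuclideanSpace ℝ (Fin N)) (τ : ℝ) : ℝ :=
  (f (x + τ • ξ) + f (x - τ • ξ) - 2 * f x) * τ ^ (-(1 + 2 * s))

theorem secondDiff_eq {s : ℝ} {f : EuclideanSpace ℝ (Fin N) → ℝ} {x ξ : EuclideanSpace ℝ (Fin N)}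
    {τ : ℝ} (hτ : 0 < τ) :
    (f (x + τ • ξ) - f x) * |τ| ^ (-(1 + 2 * s)) +
      (f (x + (-τ) • ξ) - f x) * |(-τ)| ^ (-(1 + 2 * s)) = secondDiff s f x ξ τ := by
  rw [abs_neg, abs_of_pos hτ, neg_smul, ← sub_eq_add_neg, secondDiff]; ring

/-- The sum φ(x+τξ) + φ(x-τξ) is even in τ, so its derivative at 0 vanishes and the first-order
Taylor remainder is the whole difference. -/
theorem exists_secondDiff_bound {δ ρ : ℝ} (hδ : 0 < δ) (hδρ : δ < ρ)
    {φ : EuclideanSpace ℝ (Fin N) → ℝ} {x ξ : EuclideanSpace ℝ (Fin N)}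
    (hφ : ContDiffOn ℝ 2 φ (Metric.ball x ρ)) (hξ : ‖ξ‖ = 1) :
    ∃ C, ∀ τ ∈ Icc 0 δ, |φ (x + τ • ξ) + φ (x - τ • ξ) - 2 * φ x| ≤ C * τ ^ 2 := by
  have hρ : 0 < ρ := hδ.trans hδρ
  have hmem : ∀ τ : ℝ, |τ| ≤ δ → x + τ • ξ ∈ Metric.ball x ρ := by
    intro τ hτ
    rw [mem_ball_iff_norm, add_sub_cancel_left, norm_smul, hξ, mul_one]
    exact hτ.trans_lt hδρ
  have h1 : ContDiffOn ℝ 2 (fun τ : ℝ => φ (x + τ • ξ)) (Icc 0 δ) :=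
    hφ.comp (ContDiff.contDiffOn (by fun_prop)) fun τ hτ => hmem τ (by rw [abs_of_nonneg hτ.1]; exact hτ.2)
  have h2 : ContDiffOn ℝ 2 (fun τ : ℝ => φ (x - τ • ξ)) (Icc 0 δ) :=
    hφ.comp (ContDiff.contDiffOn (by fun_prop)) fun τ hτ => by
      have := hmem (-τ) (by rw [abs_neg, abs_of_nonneg hτ.1]; exact hτ.2)
      rwa [neg_smul, ← sub_eq_add_neg] at this
  obtain ⟨C, hC⟩ := exists_taylor_mean_remainder_bound (n := 1) hδ.le
    (f := fun τ : ℝ => φ (x + τ • ξ) + φ (x - τ • ξ)) (by norm_num; exact h1.add h2)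
  refine ⟨C, fun τ hτ => ?_⟩
  have hd : HasFDerivAt φ (fderiv ℝ φ x) x :=
    ((hφ.contDiffAt (Metric.ball_mem_nhds x hρ)).differentiableAt (by norm_num)).hasFDerivAt
  have hl1 : HasDerivAt (fun τ : ℝ => x + τ • ξ) ξ 0 := by
    simpa using ((hasDerivAt_id (0 : ℝ)).smul_const ξ).const_add x
  have hl2 : HasDerivAt (fun τ : ℝ => x - τ • ξ) (-ξ) 0 := by
    simpa using ((hasDerivAt_id (0 : ℝ)).smul_const ξ).const_sub x
  have hd1 : HasDerivAt (fun τ : ℝ => φ (x + τ • ξ)) (fderiv ℝ φ x ξ) 0 :=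
    HasFDerivAt.comp_hasDerivAt (0 : ℝ) (by simpa using hd) hl1
  have hd2 : HasDerivAt (fun τ : ℝ => φ (x - τ • ξ)) (fderiv ℝ φ x (-ξ)) 0 :=
    HasFDerivAt.comp_hasDerivAt (0 : ℝ) (by simpa using hd) hl2
  have hd3 : derivWithin (fun τ : ℝ => φ (x + τ • ξ) + φ (x - τ • ξ)) (Icc 0 δ) 0 = 0 := by
    have := (hd1.add hd2).hasDerivWithinAt (s := Icc 0 δ)
    rw [map_neg, add_neg_cancel] at this
    exact this.derivWithin (uniqueDiffOn_Icc hδ 0 ⟨le_rfl, hδ.le⟩)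
  have := hC τ hτ
  rw [taylorWithinEval_succ, taylor_within_zero_eval, iteratedDerivWithin_one, hd3] at this
  simpa [two_mul] using this

/-- Second differences are O(τ²), hence integrable against the weight as s < 1. The principal value
therefore exists, which is what gives `limUnder` a meaningful value. -/
theorem innerOp_eq {s δ ρ : ℝ} (hs : s ∈ Ioo (0 : ℝ) 1) (hδ : 0 < δ) (hδρ : δ < ρ)
    {φ : EuclideanSpace ℝ (Fin N) → ℝ} {x ξ : EuclideanSpace ℝ (Fin N)}
    (hφ : ContDiffOn ℝ 2 φ (Metric.ball x ρ)) (hξ : ‖ξ‖ = 1) :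
    IntegrableOn (secondDiff s φ x ξ) (Ioo 0 δ) ∧
      innerOp s δ φ x ξ = normConst s * ∫ τ in Ioo 0 δ, secondDiff s φ x ξ τ := by
  have hmem : ∀ τ : ℝ, |τ| ≤ δ → x + τ • ξ ∈ Metric.ball x ρ := by
    intro τ hτ
    rw [mem_ball_iff_norm, add_sub_cancel_left, norm_smul, hξ, mul_one]
    exact hτ.trans_lt hδρ
  have hmem' : ∀ τ : ℝ, |τ| ≤ δ → x - τ • ξ ∈ Metric.ball x ρ := by
    intro τ hτ
    have := hmem (-τ) (by rwa [abs_neg])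
    rwa [neg_smul, ← sub_eq_add_neg] at this
  obtain ⟨C, hC⟩ := exists_secondDiff_bound hδ hδρ hφ hξ
  have hcont : ContinuousOn (secondDiff s φ x ξ) (Ioo 0 δ) := by
    unfold secondDiff
    refine ContinuousOn.mul (ContinuousOn.sub (ContinuousOn.add ?_ ?_) continuousOn_const) ?_
    · exact hφ.continuousOn.comp (by fun_prop) fun τ hτ =>
        hmem τ (by rw [abs_of_pos hτ.1]; exact hτ.2.le)
    · exact hφ.continuousOn.comp (by fun_prop) fun τ hτ =>
        hmem' τ (by rw [abs_of_pos hτ.1]; exact hτ.2.le)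
    · exact continuousOn_id.rpow_const fun τ hτ => Or.inl hτ.1.ne'
  have hint : IntegrableOn (secondDiff s φ x ξ) (Ioo 0 δ) := by
    have h1 : IntegrableOn (fun τ : ℝ => C * τ ^ (1 - 2 * s)) (Ioo 0 δ) :=
      (((intervalIntegrable_iff_integrableOn_Ioc_of_le hδ.le).1
        (intervalIntegral.intervalIntegrable_rpow' (by linarith [hs.2]))).mono_set
          Ioo_subset_Ioc_self).const_mul C
    refine h1.mono' (hcont.aestronglyMeasurable measurableSet_Ioo) ?_
    filter_upwards [ae_restrict_mem measurableSet_Ioo] with τ hτ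
    have h2 := hC τ ⟨hτ.1.le, hτ.2.le⟩
    have h3 : 0 < τ ^ (-(1 + 2 * s)) := Real.rpow_pos_of_pos hτ.1 _
    rw [secondDiff, norm_mul, Real.norm_eq_abs, Real.norm_of_nonneg h3.le]
    refine (mul_le_mul_of_nonneg_right h2 h3.le).trans_eq ?_
    rw [mul_assoc, ← Real.rpow_natCast, ← Real.rpow_add hτ.1]
    congr 2; push_cast; ring
  refine ⟨hint, ?_⟩
  unfold innerOp
  congr 1
  refine Tendsto.limUnder_eq ?_
  have hcov : AECover (volume.restrict (Ioo 0 δ)) (𝓝[>] (0 : ℝ)) (fun ε => Ici ε) := by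
    refine ⟨?_, fun ε => measurableSet_Ici⟩
    filter_upwards [ae_restrict_mem measurableSet_Ioo] with τ hτ
    filter_upwards [Ioo_mem_nhdsGT hτ.1] with ε hε using hε.2.le
  have hlim := hcov.integral_tendsto_of_countably_generated hint
  refine hlim.congr' ?_
  filter_upwards [self_mem_nhdsWithin] with ε hε
  have hε' : (0 : ℝ) < ε := hε
  rw [Measure.restrict_restrict measurableSet_Ici]
  have hset : Ici ε ∩ Ioo 0 δ = Ico ε δ := by
    ext τ; simp only [mem_inter_iff, mem_Ici, mem_Ioo, mem_Ico]
    exact ⟨fun h => ⟨h.1, h.2.2⟩, fun h => ⟨h.1, hε'.trans_le h.1, h.2⟩⟩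
  have hann : IntegrableOn (fun τ => (φ (x + τ • ξ) - φ x) * |τ| ^ (-(1 + 2 * s)))
      {τ : ℝ | |τ| ∈ Ico ε δ} := by
    have hK : IsCompact {τ : ℝ | |τ| ∈ Icc ε δ} := by
      refine Metric.isCompact_of_isClosed_isBounded (isClosed_Icc.preimage continuous_abs) ?_
      refine (Metric.isBounded_Icc (-δ) δ).subset fun τ hτ => abs_le.1 hτ.2
    refine (ContinuousOn.integrableOn_compact hK ?_).mono_set fun τ hτ => ⟨hτ.1, hτ.2.le⟩
    refine ContinuousOn.mul (ContinuousOn.sub ?_ continuousOn_const) ?_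
    · exact hφ.continuousOn.comp (by fun_prop) fun τ hτ => hmem τ hτ.2
    · exact continuous_abs.continuousOn.rpow_const fun τ hτ => Or.inl (hε'.trans_le hτ.1).ne'
  have := (setIntegral_abs_mem measurableSet_Ico
    (fun τ hτ => hε'.trans_le hτ.1) hann).2
  rw [hset]
  refine Eq.trans ?_ this.symm
  exact setIntegral_congr_fun measurableSet_Ico fun τ hτ =>
    (secondDiff_eq (hε'.trans_le hτ.1)).symm

theorem extIntegral_mono {A : Set ℝ} (hA : MeasurableSet A) {f g : ℝ → ℝ}
    (h : ∀ τ ∈ A, f τ ≤ g τ) : extIntegral A f ≤ extIntegral A g := by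
  unfold extIntegral
  refine EReal.sub_le_sub ?_ ?_
  · exact EReal.coe_ennreal_le_coe_ennreal_iff.2
      (setLIntegral_mono' hA fun τ hτ => ENNReal.ofReal_le_ofReal (h τ hτ))
  · exact EReal.coe_ennreal_le_coe_ennreal_iff.2
      (setLIntegral_mono' hA fun τ hτ => ENNReal.ofReal_le_ofReal (neg_le_neg (h τ hτ)))

theorem extIntegral_eq_integral {A : Set ℝ} {f : ℝ → ℝ} (hf : IntegrableOn f A) :
    extIntegral A f = ((∫ τ in A, f τ : ℝ) : EReal) := by
  have h1 : ∫⁻ τ in A, ENNReal.ofReal (f τ) ≠ ∞ := hf.lintegral_lt_top.ne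
  have h2 : ∫⁻ τ in A, ENNReal.ofReal (-f τ) ≠ ∞ := hf.neg.lintegral_lt_top.ne
  rw [extIntegral, integral_eq_lintegral_pos_part_sub_lintegral_neg_part hf, EReal.coe_sub,
    EReal.coe_ennreal_toReal h1, EReal.coe_ennreal_toReal h2]

/-- The comparison in `EReal` needs neither measurability nor integrability of the functions, so it
applies to any supersolution. -/
theorem outerOp_mono {s δ : ℝ} (hs : s ∈ Ioo (0 : ℝ) 1) {f g : EuclideanSpace ℝ (Fin N) → ℝ}
    {x ξ : EuclideanSpace ℝ (Fin N)} (h : ∀ y, f y - f x ≤ g y - g x) :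
    outerOp s δ f x ξ ≤ outerOp s δ g x ξ := by
  unfold outerOp
  refine mul_le_mul_of_nonneg_left (extIntegral_mono
    (measurableSet_le measurable_const measurable_id.abs) fun τ _ => ?_)
    (EReal.coe_nonneg.2 (normConst_pos hs).le)
  exact mul_le_mul_of_nonneg_right (h _) (Real.rpow_nonneg (abs_nonneg τ) _)

theorem outerOp_eq {s δ M : ℝ} (hs : s ∈ Ioo (0 : ℝ) 1) (hδ : 0 < δ)
    {f : EuclideanSpace ℝ (Fin N) → ℝ} {x ξ : EuclideanSpace ℝ (Fin N)}
    (hf : Continuous f) (hM : ∀ y, |f y| ≤ M) :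
    IntegrableOn (secondDiff s f x ξ) (Ici δ) ∧
      outerOp s δ f x ξ = ((normConst s * ∫ τ in Ici δ, secondDiff s f x ξ τ : ℝ) : EReal) := by
  have hsub : Ici δ ⊆ Ioi (0 : ℝ) := fun τ hτ => hδ.trans_le hτ
  have hpow : IntegrableOn (fun τ : ℝ => |τ| ^ (-(1 + 2 * s))) {τ : ℝ | |τ| ∈ Ici δ} := by
    have h1 : IntegrableOn (fun τ : ℝ => |τ| ^ (-(1 + 2 * s))) (Ici δ) := by
      rw [integrableOn_Ici_iff_integrableOn_Ioi]
      exact (integrableOn_Ioi_rpow_of_lt (a := -(1 + 2 * s)) (by linarith [hs.1]) hδ).congr_fun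
        (fun τ hτ => by simp only [abs_of_pos (hδ.trans hτ)]) measurableSet_Ioi
    have h2 : IntegrableOn (fun τ : ℝ => |τ| ^ (-(1 + 2 * s))) (Iic (-δ)) := by
      have := (Measure.measurePreserving_neg (volume : Measure ℝ)).integrableOn_comp_preimage
        (Homeomorph.neg ℝ).measurableEmbedding (f := fun τ : ℝ => |τ| ^ (-(1 + 2 * s)))
        (s := Ici δ)
      have e : (Neg.neg : ℝ → ℝ) ⁻¹' Ici δ = Iic (-δ) := by ext; simp
      have e2 : (fun τ : ℝ => |τ| ^ (-(1 + 2 * s))) ∘ (Neg.neg : ℝ → ℝ) =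
          fun τ : ℝ => |τ| ^ (-(1 + 2 * s)) := by ext; simp
      rw [e, e2] at this
      exact this.2 h1
    refine (h1.union h2).mono_set fun τ hτ => ?_
    rcases le_abs.1 (show δ ≤ |τ| from hτ) with h | h
    · exact Or.inl h
    · exact Or.inr (by simp only [mem_Iic]; linarith)
  have hint : IntegrableOn (fun τ => (f (x + τ • ξ) - f x) * |τ| ^ (-(1 + 2 * s)))
      {τ : ℝ | |τ| ∈ Ici δ} := by
    refine Integrable.bdd_mul (c := 2 * M) hpow
      (Continuous.aestronglyMeasurable (by fun_prop)) (Eventually.of_forall fun τ => ?_)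
    have a := abs_le.1 (hM (x + τ • ξ))
    have b := abs_le.1 (hM x)
    exact abs_le.2 ⟨by linarith, by linarith⟩
  obtain ⟨h1, h2⟩ := setIntegral_abs_mem measurableSet_Ici hsub hint
  refine ⟨h1.congr_fun (fun τ hτ => secondDiff_eq (hsub hτ)) measurableSet_Ici, ?_⟩
  have h3 : extIntegral {τ : ℝ | δ ≤ |τ|} (fun τ => (f (x + τ • ξ) - f x) * |τ| ^ (-(1 + 2 * s))) =
      ((∫ τ in Ici δ, secondDiff s f x ξ τ : ℝ) : EReal) := by
    refine (extIntegral_eq_integral hint).trans ?_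
    rw [h2]
    exact congrArg _ (setIntegral_congr_fun measurableSet_Ici fun τ hτ => secondDiff_eq (hsub hτ))
  rw [outerOp, h3, EReal.coe_mul]

/-! ### Testing with bounded functions of class `C²` -/

theorem integrableOn_secondDiff {s M : ℝ} (hs : s ∈ Ioo (0 : ℝ) 1)
    {f : EuclideanSpace ℝ (Fin N) → ℝ} {x ξ : EuclideanSpace ℝ (Fin N)}
    (hf : ContDiff ℝ 2 f) (hM : ∀ y, |f y| ≤ M) (hξ : ‖ξ‖ = 1) :
    IntegrableOn (secondDiff s f x ξ) (Ioi 0) := by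
  have h1 := (innerOp_eq (x := x) hs one_pos one_lt_two hf.contDiffOn hξ).1
  have h2 := (outerOp_eq (x := x) (ξ := ξ) hs one_pos hf.continuous hM).1
  rw [← Ioo_union_Ici_eq_Ioi one_pos]
  exact h1.union h2

theorem innerOp_add_outerOp {s δ M : ℝ} (hs : s ∈ Ioo (0 : ℝ) 1) (hδ : 0 < δ)
    {f : EuclideanSpace ℝ (Fin N) → ℝ} {x ξ : EuclideanSpace ℝ (Fin N)}
    (hf : ContDiff ℝ 2 f) (hM : ∀ y, |f y| ≤ M) (hξ : ‖ξ‖ = 1) :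
    ((innerOp s δ f x ξ : ℝ) : EReal) + outerOp s δ f x ξ =
      ((normConst s * ∫ τ in Ioi 0, secondDiff s f x ξ τ : ℝ) : EReal) := by
  obtain ⟨h1, h2⟩ := innerOp_eq (x := x) hs hδ (lt_add_one δ) hf.contDiffOn hξ
  obtain ⟨h3, h4⟩ := outerOp_eq (x := x) (ξ := ξ) hs hδ hf.continuous hM
  rw [h2, h4, ← EReal.coe_add, ← Ioo_union_Ici_eq_Ioi hδ, setIntegral_union _ measurableSet_Ici h1 h3,
    mul_add]
  exact Set.disjoint_left.2 fun τ h h' => not_lt.2 h' h.2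

theorem EReal.coe_finset_sum_real {ι : Type*} (S : Finset ι) (f : ι → ℝ) :
    ((∑ i ∈ S, f i : ℝ) : EReal) = ∑ i ∈ S, (f i : EReal) := by
  classical
  induction S using Finset.induction_on with
  | empty => simp
  | insert a S ha ih => rw [Finset.sum_insert ha, Finset.sum_insert ha, EReal.coe_add, ih]

/-- As ψ touches from below globally, the increments of u at y dominate those of ψ, and ψ may
replace u in the outer part too. The infimum over frames is handled through a common lower bound V.
-/
theorem IsViscositySupersolution.le_of_touching {k : ℕ} {s p M V : ℝ} (hs : s ∈ Ioo (0 : ℝ) 1)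
    {u ψ : EuclideanSpace ℝ (Fin N) → ℝ} (hu : IsViscositySupersolution k s p u)
    (hψ : ContDiff ℝ 2 ψ) (hM : ∀ y, |ψ y| ≤ M) {y : EuclideanSpace ℝ (Fin N)}
    (hy : ∀ x, u y - ψ y ≤ u x - ψ x)
    (hV : ∀ ξ : Fin k → EuclideanSpace ℝ (Fin N), Orthonormal ℝ ξ →
      V ≤ ∑ i, normConst s * ∫ τ in Ioi 0, secondDiff s ψ y (ξ i) τ) :
    V + u y ^ p ≤ 0 := by
  have h := hu.test y 1 2 ψ one_pos one_lt_two hψ.contDiffOn (fun x _ => hy x)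
  have hle : (V : EReal) ≤ minimalOp k s 1 u ψ y := by
    refine le_iInf fun ξ => ?_
    refine (EReal.coe_le_coe_iff.2 (hV ξ.1 ξ.2)).trans ?_
    rw [EReal.coe_finset_sum_real]
    refine Finset.sum_le_sum fun i _ => ?_
    rw [← innerOp_add_outerOp hs one_pos hψ hM (ξ.2.1 i)]
    exact add_le_add_right (outerOp_mono hs fun x => by linarith [hy x]) _
  have h2 := (add_le_add_left hle _).trans h
  rw [← EReal.coe_add] at h2
  exact_mod_cast h2

/-- One good frame at each point bounds the infimum, and a test function touching from below has
smaller second differences than u. -/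
theorem isViscositySupersolution_of_contDiff {k : ℕ} {s p M : ℝ} (hs : s ∈ Ioo (0 : ℝ) 1)
    {u : EuclideanSpace ℝ (Fin N) → ℝ} (hu : ContDiff ℝ 2 u) (hM : ∀ y, |u y| ≤ M)
    (h0 : ∀ y, 0 ≤ u y)
    (hframe : ∀ x, ∃ ξ : Fin k → EuclideanSpace ℝ (Fin N), Orthonormal ℝ ξ ∧
      (∑ i, normConst s * ∫ τ in Ioi 0, secondDiff s u x (ξ i) τ) + u x ^ p ≤ 0) :
    IsViscositySupersolution k s p u := by
  refine ⟨h0, hu.continuous.lowerSemicontinuous, fun x δ ρ φ hδ hδρ hφ hmin => ?_⟩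
  obtain ⟨ξ, hξ, hle⟩ := hframe x
  have h1 : minimalOp k s δ u φ x ≤
      ((∑ i, normConst s * ∫ τ in Ioi 0, secondDiff s u x (ξ i) τ : ℝ) : EReal) := by
    refine (iInf_le _ (⟨ξ, hξ⟩ : {ξ : Fin k → EuclideanSpace ℝ (Fin N) // Orthonormal ℝ ξ})).trans ?_
    rw [EReal.coe_finset_sum_real]
    refine Finset.sum_le_sum fun i _ => ?_
    rw [← innerOp_add_outerOp hs hδ hu hM (hξ.1 i)]
    refine add_le_add_left (EReal.coe_le_coe_iff.2 ?_) _
    obtain ⟨i1, e1⟩ := innerOp_eq hs hδ hδρ hφ (hξ.1 i)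
    obtain ⟨i2, e2⟩ := innerOp_eq (x := x) hs hδ hδρ hu.contDiffOn (hξ.1 i)
    rw [e1, e2]
    refine mul_le_mul_of_nonneg_left (setIntegral_mono_on i1 i2 measurableSet_Ioo fun τ hτ => ?_)
      (normConst_pos hs).le
    refine mul_le_mul_of_nonneg_right ?_ (Real.rpow_nonneg hτ.1.le _)
    have hm1 : x + τ • ξ i ∈ Metric.ball x δ := by
      rw [mem_ball_iff_norm, add_sub_cancel_left, norm_smul, hξ.1 i, mul_one, Real.norm_eq_abs,
        abs_of_pos hτ.1]
      exact hτ.2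
    have hm2 : x - τ • ξ i ∈ Metric.ball x δ := by
      rw [mem_ball_iff_norm, sub_sub_cancel_left, norm_neg, norm_smul, hξ.1 i, mul_one,
        Real.norm_eq_abs, abs_of_pos hτ.1]
      exact hτ.2
    have a1 : u x - φ x ≤ u (x + τ • ξ i) - φ (x + τ • ξ i) := hmin hm1
    have a2 : u x - φ x ≤ u (x - τ • ξ i) - φ (x - τ • ξ i) := hmin hm2
    linarith
  refine (add_le_add_left h1 _).trans ?_
  rw [← EReal.coe_add]
  exact_mod_cast hle

/-! ### Regularized powers -/

/-- The function `x ↦ (L² + |x - z|²)^(-γ/2)`. -/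
noncomputable def regPower (γ L : ℝ) (z x : EuclideanSpace ℝ (Fin N)) : ℝ :=
  (L ^ 2 + ‖x - z‖ ^ 2) ^ (-γ / 2)

theorem regPower_base_pos {L : ℝ} (hL : 0 < L) (z x : EuclideanSpace ℝ (Fin N)) :
    0 < L ^ 2 + ‖x - z‖ ^ 2 := by positivity

theorem contDiff_regPower {γ L : ℝ} (hL : 0 < L) (z : EuclideanSpace ℝ (Fin N)) :
    ContDiff ℝ 2 (regPower γ L z) := by
  unfold regPower
  refine ContDiff.rpow_const_of_ne ?_ fun x => (regPower_base_pos hL z x).ne'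
  exact contDiff_const.add ((contDiff_id.sub contDiff_const).norm_sq ℝ)

theorem regPower_pos {γ L : ℝ} (hL : 0 < L) (z x : EuclideanSpace ℝ (Fin N)) :
    0 < regPower γ L z x := Real.rpow_pos_of_pos (regPower_base_pos hL z x) _

theorem sq_rpow_half {L : ℝ} (hL : 0 ≤ L) (γ : ℝ) : (L ^ 2) ^ (-γ / 2) = L ^ (-γ) := by
  rw [← Real.rpow_natCast, ← Real.rpow_mul hL]; congr 1; push_cast; ring

theorem regPower_le {γ L : ℝ} (hγ : 0 ≤ γ) (hL : 0 < L) (z x : EuclideanSpace ℝ (Fin N)) :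
    regPower γ L z x ≤ L ^ (-γ) := by
  rw [← sq_rpow_half hL.le]
  exact Real.rpow_le_rpow_of_nonpos (by positivity) (by nlinarith [sq_nonneg ‖x - z‖]) (by linarith)

theorem abs_regPower_le {γ L : ℝ} (hγ : 0 ≤ γ) (hL : 0 < L) (z x : EuclideanSpace ℝ (Fin N)) :
    |regPower γ L z x| ≤ L ^ (-γ) := by
  rw [abs_of_pos (regPower_pos hL z x)]; exact regPower_le hγ hL z x

/-- The squared cosine of the regularized angle. -/
noncomputable def cosSq (L : ℝ) (z x ξ : EuclideanSpace ℝ (Fin N)) : ℝ :=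
  inner ℝ (x - z) ξ ^ 2 / (L ^ 2 + ‖x - z‖ ^ 2)

theorem cosSq_mem {L : ℝ} (hL : 0 < L) {z x ξ : EuclideanSpace ℝ (Fin N)} (hξ : ‖ξ‖ = 1) :
    cosSq L z x ξ ∈ Ico (0 : ℝ) 1 := by
  have hA := regPower_base_pos hL z x
  refine ⟨by unfold cosSq; positivity, ?_⟩
  rw [cosSq, div_lt_one hA]
  have h := abs_real_inner_le_norm (x - z) ξ
  rw [hξ, mul_one] at h
  have h2 := pow_le_pow_left₀ (abs_nonneg _) h 2
  rw [sq_abs] at h2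
  nlinarith

/-- Measuring τ in units of √A, A = L² + |x-z|², turns the base along the line into A(1 + v² ± 2v
cos θ). The sign of cos θ is lost in the symmetric sum, so only its square matters. -/
theorem secondDiff_regPower {s γ L : ℝ} (hL : 0 < L) {z x ξ : EuclideanSpace ℝ (Fin N)}
    (hξ : ‖ξ‖ = 1) {v : ℝ} (hv : 0 < v) :
    secondDiff s (regPower γ L z) x ξ (√(L ^ 2 + ‖x - z‖ ^ 2) * v) =
      (L ^ 2 + ‖x - z‖ ^ 2) ^ (-γ / 2 - s - 1 / 2) * profileIntegrand s γ (cosSq L z x ξ) v := by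
  have hA := regPower_base_pos hL z x
  have ht := cosSq_mem hL (z := z) (x := x) hξ
  set A := L ^ 2 + ‖x - z‖ ^ 2 with hAd
  have hsA : 0 < √A := Real.sqrt_pos.2 hA
  have hsq : √A ^ 2 = A := Real.sq_sqrt hA.le
  have hline : ∀ r : ℝ, L ^ 2 + ‖x + r • ξ - z‖ ^ 2 = A + 2 * r * inner ℝ (x - z) ξ + r ^ 2 := by
    intro r
    have : x + r • ξ - z = (x - z) + r • ξ := by abel
    rw [this, norm_add_sq_real, norm_smul, hξ, inner_smul_right, hAd, mul_one, Real.norm_eq_abs,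
      sq_abs]
    ring
  have hcos : √(cosSq L z x ξ) = |inner ℝ (x - z) ξ| / √A := by
    rw [cosSq, Real.sqrt_div (sq_nonneg _), Real.sqrt_sq_eq_abs]
  have hval : ∀ r : ℝ, regPower γ L z (x + (√A * r) • ξ) =
      A ^ (-γ / 2) * (1 + r ^ 2 + 2 * (inner ℝ (x - z) ξ / √A) * r) ^ (-γ / 2) := by
    intro r
    rw [regPower, hline]
    have e : A + 2 * (√A * r) * inner ℝ (x - z) ξ + (√A * r) ^ 2 =
        A * (1 + r ^ 2 + 2 * (inner ℝ (x - z) ξ / √A) * r) := by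
      have : A * (inner ℝ (x - z) ξ / √A) = √A * inner ℝ (x - z) ξ := by
        rw [← hsq, Real.sqrt_sq hsA.le]; field_simp
      rw [mul_pow, hsq]
      linear_combination -(2 * r) * this
    have hp : 0 ≤ 1 + r ^ 2 + 2 * (inner ℝ (x - z) ξ / √A) * r := by
      have h1 := hline (√A * r)
      rw [e] at h1
      have h2 := regPower_base_pos hL z (x + (√A * r) • ξ)
      rw [h1] at h2
      exact (pos_of_mul_pos_right h2 hA.le).le
    rw [e, Real.mul_rpow hA.le hp]
  have hx : regPower γ L z x = A ^ (-γ / 2) := rfl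
  have hminus : x - (√A * v) • ξ = x + (√A * (-v)) • ξ := by
    rw [mul_neg, neg_smul, sub_eq_add_neg]
  rw [secondDiff, hminus, hval, hval, hx, profileIntegrand, hcos]
  have hpow : (√A * v) ^ (-(1 + 2 * s)) = A ^ (-s - 1 / 2) * (v ^ (1 + 2 * s))⁻¹ := by
    rw [Real.mul_rpow hsA.le hv.le, Real.rpow_neg hv.le, Real.sqrt_eq_rpow, ← Real.rpow_mul hA.le]
    congr 2; ring
  have hexp : A ^ (-γ / 2 - s - 1 / 2) = A ^ (-γ / 2) * A ^ (-s - 1 / 2) := by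
    rw [← Real.rpow_add hA]; congr 1; ring
  rw [hpow, hexp]
  rcases le_total 0 (inner ℝ (x - z) ξ) with h | h
  · rw [abs_of_nonneg h]; ring_nf
  · rw [abs_of_nonpos h]; ring_nf

theorem integral_secondDiff_regPower {s γ L : ℝ} (hL : 0 < L)
    {z x ξ : EuclideanSpace ℝ (Fin N)} (hξ : ‖ξ‖ = 1) :
    ∫ τ in Ioi 0, secondDiff s (regPower γ L z) x ξ τ =
      (L ^ 2 + ‖x - z‖ ^ 2) ^ (-γ / 2 - s) * profile s γ (cosSq L z x ξ) := by
  have hA := regPower_base_pos hL z x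
  have hsA := Real.sqrt_pos.2 hA
  have h := integral_comp_mul_left_Ioi (secondDiff s (regPower γ L z) x ξ) 0 hsA
  rw [mul_zero, setIntegral_congr_fun measurableSet_Ioi
    (fun v hv => secondDiff_regPower (s := s) (γ := γ) hL hξ hv), integral_const_mul, smul_eq_mul,
    eq_inv_mul_iff_mul_eq₀ hsA.ne'] at h
  rw [← h, ← mul_assoc, profile, Real.sqrt_eq_rpow, ← Real.rpow_add hA]
  congr 2; ring

theorem sum_cosSq {L : ℝ} {z x : EuclideanSpace ℝ (Fin N)}
    {ξ : Fin N → EuclideanSpace ℝ (Fin N)} (hξ : Orthonormal ℝ ξ) :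
    ∑ i, cosSq L z x (ξ i) = ‖x - z‖ ^ 2 / (L ^ 2 + ‖x - z‖ ^ 2) := by
  simp only [cosSq, ← Finset.sum_div]
  congr 1
  have hspan : ⊤ ≤ Submodule.span ℝ (Set.range ξ) := by
    rw [hξ.linearIndependent.span_eq_top_of_card_eq_finrank' (by simp)]
  have h := (OrthonormalBasis.mk hξ hspan).sum_sq_norm_inner_left (x - z)
  simpa using h

/-- The regularized mean squared cosine between `x - z` and the vectors of a frame. -/
noncomputable def meanCosSq (L : ℝ) (z x : EuclideanSpace ℝ (Fin N)) : ℝ :=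
  ‖x - z‖ ^ 2 / (L ^ 2 + ‖x - z‖ ^ 2) / N

/-- Jensen together with Parseval: the lower bound no longer depends on the frame. -/
theorem card_mul_profile_meanCosSq_le (hN : 0 < N) {s γ L : ℝ} (hs : s ∈ Ioo (0 : ℝ) 1)
    (hγ : 0 < γ) (hL : 0 < L) {z x : EuclideanSpace ℝ (Fin N)}
    {ξ : Fin N → EuclideanSpace ℝ (Fin N)} (hξ : Orthonormal ℝ ξ) :
    (L ^ 2 + ‖x - z‖ ^ 2) ^ (-γ / 2 - s) * (N * profile s γ (meanCosSq L z x)) ≤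
      ∑ i, ∫ τ in Ioi 0, secondDiff s (regPower γ L z) x (ξ i) τ := by
  have h := card_mul_profile_le_sum hN hs hγ (fun i => cosSq L z x (ξ i))
    fun i => cosSq_mem hL (hξ.1 i)
  rw [sum_cosSq hξ] at h
  simp only [fun i => integral_secondDiff_regPower (s := s) (γ := γ) (z := z) (x := x) hL (hξ.1 i)]
  rw [← Finset.mul_sum]
  exact mul_le_mul_of_nonneg_left h (Real.rpow_nonneg (regPower_base_pos hL z x).le _)

/-- Touching a supersolution from below by a positive combination of two regularized powers. -/
theorem IsViscositySupersolution.touch_regPower {s p : ℝ} (hN : 0 < N) (hs : s ∈ Ioo (0 : ℝ) 1)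
    {u : EuclideanSpace ℝ (Fin N) → ℝ} (hu : IsViscositySupersolution N s p u)
    {a b γ₁ γ₂ L₁ L₂ : ℝ} (ha : 0 ≤ a) (hb : 0 ≤ b) (hγ₁ : 0 < γ₁) (hγ₂ : 0 < γ₂)
    (hL₁ : 0 < L₁) (hL₂ : 0 < L₂) {z₁ z₂ y : EuclideanSpace ℝ (Fin N)}
    (hy : ∀ x, u y - (a * regPower γ₁ L₁ z₁ y + b * regPower γ₂ L₂ z₂ y) ≤
      u x - (a * regPower γ₁ L₁ z₁ x + b * regPower γ₂ L₂ z₂ x)) :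
    normConst s * N * (a * ((L₁ ^ 2 + ‖y - z₁‖ ^ 2) ^ (-γ₁ / 2 - s) *
          profile s γ₁ (meanCosSq L₁ z₁ y)) +
        b * ((L₂ ^ 2 + ‖y - z₂‖ ^ 2) ^ (-γ₂ / 2 - s) * profile s γ₂ (meanCosSq L₂ z₂ y))) +
      u y ^ p ≤ 0 := by
  have hc1 := contDiff_regPower (γ := γ₁) hL₁ z₁
  have hc2 := contDiff_regPower (γ := γ₂) hL₂ z₂
  refine hu.le_of_touching (M := a * L₁ ^ (-γ₁) + b * L₂ ^ (-γ₂)) hs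
    ((contDiff_const.mul hc1).add (contDiff_const.mul hc2)) (fun x => ?_) hy fun ξ hξ => ?_
  · rw [abs_of_nonneg (add_nonneg (mul_nonneg ha (regPower_pos hL₁ _ _).le)
      (mul_nonneg hb (regPower_pos hL₂ _ _).le))]
    exact add_le_add (mul_le_mul_of_nonneg_left (regPower_le hγ₁.le hL₁ _ _) ha)
      (mul_le_mul_of_nonneg_left (regPower_le hγ₂.le hL₂ _ _) hb)
  · have h1 := card_mul_profile_meanCosSq_le hN hs hγ₁ hL₁ (z := z₁) (x := y) hξ
    have h2 := card_mul_profile_meanCosSq_le hN hs hγ₂ hL₂ (z := z₂) (x := y) hξ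
    have e : ∀ i, ∫ τ in Ioi 0, secondDiff s (fun x => a * regPower γ₁ L₁ z₁ x +
        b * regPower γ₂ L₂ z₂ x) y (ξ i) τ =
        a * (∫ τ in Ioi 0, secondDiff s (regPower γ₁ L₁ z₁) y (ξ i) τ) +
        b * ∫ τ in Ioi 0, secondDiff s (regPower γ₂ L₂ z₂) y (ξ i) τ := by
      intro i
      have i1 := (integrableOn_secondDiff hs hc1 (abs_regPower_le hγ₁.le hL₁ z₁)
        (x := y) (hξ.1 i)).const_mul a
      have i2 := (integrableOn_secondDiff hs hc2 (abs_regPower_le hγ₂.le hL₂ z₂)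
        (x := y) (hξ.1 i)).const_mul b
      rw [← integral_const_mul, ← integral_const_mul, ← integral_add i1 i2]
      congr 1; ext τ
      simp only [secondDiff]; ring
    simp only [e]
    rw [← Finset.mul_sum, Finset.sum_add_distrib, ← Finset.mul_sum, ← Finset.mul_sum, mul_assoc]
    refine mul_le_mul_of_nonneg_left ?_ (normConst_pos hs).le
    have := add_le_add (mul_le_mul_of_nonneg_left h1 ha) (mul_le_mul_of_nonneg_left h2 hb)
    refine le_trans (le_of_eq ?_) this
    ring

/-! ### Existence above the critical exponent -/

/-- The vector with all coordinates ‖x‖/√N has equal angles with the standard basis; a reflection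
carrying it to x carries that basis to the required one. -/
theorem exists_orthonormal_inner_sq_eq (hN : 0 < N) (x : EuclideanSpace ℝ (Fin N)) :
    ∃ ξ : Fin N → EuclideanSpace ℝ (Fin N), Orthonormal ℝ ξ ∧
      ∀ i, inner ℝ x (ξ i) ^ 2 = ‖x‖ ^ 2 / N := by
  have hN' : (0 : ℝ) < N := by exact_mod_cast hN
  set e := EuclideanSpace.basisFun (Fin N) ℝ with he
  set w : EuclideanSpace ℝ (Fin N) := (‖x‖ / √N) • WithLp.toLp 2 (fun _ => (1 : ℝ)) with hw
  have hnw : ‖w‖ = ‖x‖ := by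
    have h1 : ‖(WithLp.toLp 2 (fun _ => (1 : ℝ)) : EuclideanSpace ℝ (Fin N))‖ = √N := by
      simp [EuclideanSpace.norm_eq]
    rw [hw, norm_smul, h1, Real.norm_of_nonneg (by positivity),
      div_mul_cancel₀ _ (Real.sqrt_pos.2 hN').ne']
  set R := (Submodule.span ℝ {w - x})ᗮ.reflection with hR
  have hRw : R w = x := Submodule.reflection_sub hnw
  refine ⟨fun i => R (e i), e.orthonormal.comp_linearIsometryEquiv R, fun i => ?_⟩
  nth_rewrite 1 [← hRw]
  rw [LinearIsometryEquiv.inner_map_map, hw, inner_smul_left]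
  simp [he, div_pow, Real.sq_sqrt hN'.le, EuclideanSpace.inner_single_right]

theorem integrable_one_div_one_add_abs_rpow {r : ℝ} (hr : 1 < r) :
    Integrable (fun τ : ℝ => 1 / (1 + |τ| ^ r)) := by
  have h := (integrable_one_add_norm (E := ℝ) (μ := volume) (r := r) (by simpa using hr)).const_mul
    (2 ^ r)
  refine h.mono' (Measurable.aestronglyMeasurable (by fun_prop)) (Eventually.of_forall fun τ => ?_)
  have h0 := abs_nonneg τ
  have h1 : 0 ≤ |τ| ^ r := Real.rpow_nonneg h0 _
  rw [Real.norm_of_nonneg (by positivity), Real.norm_eq_abs, Real.rpow_neg (by positivity),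
    ← div_eq_mul_inv, div_le_div_iff₀ (by positivity) (by positivity), one_mul]
  rcases le_total |τ| 1 with h2 | h2
  · calc (1 + |τ|) ^ r ≤ 2 ^ r := Real.rpow_le_rpow (by positivity) (by linarith) (by linarith)
      _ ≤ _ := le_mul_of_one_le_right (by positivity) (by linarith)
  · calc (1 + |τ|) ^ r ≤ (2 * |τ|) ^ r :=
        Real.rpow_le_rpow (by positivity) (by linarith) (by linarith)
      _ = 2 ^ r * |τ| ^ r := Real.mul_rpow (by norm_num) h0
      _ ≤ _ := mul_le_mul_of_nonneg_left (by linarith) (by positivity)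

theorem lineIntegrable_of_bounded {σ M : ℝ} (hσ : 0 < σ) {u : EuclideanSpace ℝ (Fin N) → ℝ}
    (hu : Continuous u) (hM : ∀ x, |u x| ≤ M) : LineIntegrable σ u := by
  intro x ξ _
  have h := (integrable_one_div_one_add_abs_rpow (show 1 < 1 + σ by linarith)).const_mul M
  have hm : Measurable fun τ : ℝ => |u (x + τ • ξ)| :=
    (Continuous.measurable (by fun_prop)).abs
  refine h.mono' (hm.div (by fun_prop)).aestronglyMeasurable (Eventually.of_forall fun τ => ?_)
  have h1 : 0 ≤ |τ| ^ (1 + σ) := Real.rpow_nonneg (abs_nonneg τ) _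
  rw [Real.norm_of_nonneg (by positivity), mul_one_div]
  exact div_le_div_of_nonneg_right (hM _) (by positivity)

/-- The relation between γ and p says γp = γ + 2s, so both terms of the equation scale like
A^(-γ/2-s). The factor k, with k^(p-1) = K, balances them at the profile value for 1/N, and the
actual squared cosines are smaller. -/
theorem exists_supersolution {s p γ : ℝ} (hN : 2 ≤ N) (hs : s ∈ Ioo (0 : ℝ) 1) (hγ : 0 < γ)
    (hp : γ * (p - 1) = 2 * s) (hneg : profile s γ (1 / N) < 0) :
    ∃ u : EuclideanSpace ℝ (Fin N) → ℝ, IsViscositySupersolution N s p u ∧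
      LineIntegrable (2 * s) u ∧ ∃ x, u x ≠ 0 := by
  have hN' : (2 : ℝ) ≤ N := by exact_mod_cast hN
  have hC := normConst_pos hs
  have hp1 : 0 < p - 1 := pos_of_mul_pos_right (by rw [hp]; linarith [hs.1]) hγ.le
  set K := normConst s * N * (-profile s γ (1 / N)) with hK
  have hK0 : 0 < K := mul_pos (mul_pos hC (by linarith)) (neg_pos.2 hneg)
  set k := K ^ (1 / (p - 1)) with hk
  have hk0 : 0 < k := Real.rpow_pos_of_pos hK0 _
  have hkp : k ^ p = k * K := by
    have h1 : k ^ (p - 1) = K := by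
      rw [hk, ← Real.rpow_mul hK0.le, one_div_mul_cancel hp1.ne', Real.rpow_one]
    rw [← h1, ← Real.rpow_one_add' hk0.le (by linarith)]
    congr 1; ring
  set u : EuclideanSpace ℝ (Fin N) → ℝ := fun x => k * regPower γ 1 0 x with hu
  have hu0 : ∀ x, 0 < u x := fun x => mul_pos hk0 (regPower_pos one_pos _ _)
  have hcd : ContDiff ℝ 2 u := contDiff_const.mul (contDiff_regPower one_pos 0)
  have hM : ∀ x, |u x| ≤ k := fun x => by
    rw [abs_of_pos (hu0 x)]
    have := regPower_le hγ.le one_pos 0 x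
    rw [Real.one_rpow] at this
    exact mul_le_of_le_one_right hk0.le this
  refine ⟨u, isViscositySupersolution_of_contDiff hs hcd hM (fun x => (hu0 x).le) fun x => ?_,
    lineIntegrable_of_bounded (by linarith [hs.1]) hcd.continuous hM, 0, (hu0 0).ne'⟩
  obtain ⟨ξ, hξ, hx⟩ := exists_orthonormal_inner_sq_eq (by omega) x
  refine ⟨ξ, hξ, ?_⟩
  have hA := regPower_base_pos one_pos 0 x
  set A : ℝ := 1 ^ 2 + ‖x - 0‖ ^ 2 with hAd
  have hcos : ∀ i, cosSq 1 0 x (ξ i) = ‖x‖ ^ 2 / N / A := fun i => by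
    rw [cosSq, sub_zero, hx, hAd, sub_zero]
  have hle : ‖x‖ ^ 2 / N / A ≤ 1 / N := by
    rw [div_div, mul_comm, ← div_div]
    refine div_le_div_of_nonneg_right ?_ (by linarith)
    rw [div_le_one hA, hAd, sub_zero]; linarith
  have hprof : profile s γ (‖x‖ ^ 2 / N / A) ≤ profile s γ (1 / N) :=
    profile_mono hs hγ (by positivity) hle (by rw [div_lt_one] <;> linarith)
  have hint : ∀ i, ∫ τ in Ioi 0, secondDiff s u x (ξ i) τ =
      k * (A ^ (-γ / 2 - s) * profile s γ (‖x‖ ^ 2 / N / A)) := fun i => by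
    rw [← hcos i, ← integral_secondDiff_regPower one_pos (hξ.1 i), ← integral_const_mul]
    congr 1; ext τ
    simp only [secondDiff, hu]; ring
  have hup : u x ^ p = k * K * A ^ (-γ / 2 - s) := by
    rw [hu, Real.mul_rpow hk0.le (regPower_pos one_pos _ _).le, hkp, regPower,
      ← Real.rpow_mul hA.le]
    congr 2
    linear_combination (-1 / 2 : ℝ) * hp
  simp only [hint, Finset.sum_const, Finset.card_univ, Fintype.card_fin, nsmul_eq_mul]
  rw [hup, hK]
  have hP : 0 < A ^ (-γ / 2 - s) := Real.rpow_pos_of_pos hA _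
  have h3 : 0 ≤ normConst s * N * k * A ^ (-γ / 2 - s) := by positivity
  have := mul_le_mul_of_nonneg_left hprof h3
  linarith

/-! ### Lower bounds for supersolutions -/

theorem exists_forall_sub_le {u ψ : EuclideanSpace ℝ (Fin N) → ℝ} (hu : LowerSemicontinuous u)
    (hψ : Continuous ψ) {K : Set (EuclideanSpace ℝ (Fin N))} (hK : IsCompact K)
    {z : EuclideanSpace ℝ (Fin N)} (hz : z ∈ K) (h : ∀ x ∉ K, u z - ψ z ≤ u x - ψ x) :
    ∃ y ∈ K, ∀ x, u y - ψ y ≤ u x - ψ x := by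
  have hl : LowerSemicontinuous (fun x => u x + -ψ x) := hu.add hψ.neg.lowerSemicontinuous
  obtain ⟨y, hy, hmin⟩ := (hl.lowerSemicontinuousOn K).exists_isMinOn ⟨z, hz⟩ hK
  refine ⟨y, hy, fun x => ?_⟩
  have h1 : ∀ x ∈ K, u y - ψ y ≤ u x - ψ x := fun x hx => by
    have : u y + -ψ y ≤ u x + -ψ x := hmin hx
    linarith
  by_cases hx : x ∈ K
  · exact h1 x hx
  · exact (h1 z hz).trans (h x hx)

theorem tendsto_regPower_cocompact {γ L : ℝ} (hγ : 0 < γ) (z : EuclideanSpace ℝ (Fin N)) :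
    Tendsto (regPower γ L z) (cocompact _) (𝓝 0) := by
  have h1 : Tendsto (fun x : EuclideanSpace ℝ (Fin N) => ‖x - z‖) (cocompact _) atTop :=
    (tendsto_norm_cocompact_atTop (E := EuclideanSpace ℝ (Fin N))).comp
      (Homeomorph.subRight z).isClosedEmbedding.tendsto_cocompact
  have h2 : Tendsto (fun x : EuclideanSpace ℝ (Fin N) => L ^ 2 + ‖x - z‖ ^ 2) (cocompact _) atTop :=
    tendsto_atTop_add_const_left _ _ ((tendsto_pow_atTop two_ne_zero).comp h1)
  have h3 := (tendsto_rpow_neg_atTop (half_pos hγ)).comp h2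
  refine h3.congr fun x => ?_
  simp only [Function.comp, regPower, neg_div]

/-- Regularizing lowers the mean squared cosine by a multiple of L²/(L²+|x-z|²), and the profile is
Lipschitz from the left at 1/N. -/
theorem profile_meanCosSq_ge (hN : 2 ≤ N) {s γ : ℝ} (hs : s ∈ Ioo (0 : ℝ) 1) (hγ : 0 < γ) :
    ∃ C, 0 ≤ C ∧ ∀ (L : ℝ) (z x : EuclideanSpace ℝ (Fin N)), 0 < L →
      profile s γ (1 / N) - C * (L ^ 2 / (L ^ 2 + ‖x - z‖ ^ 2)) ≤
        profile s γ (meanCosSq L z x) := by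
  have hN' : (2 : ℝ) ≤ N := by exact_mod_cast hN
  obtain ⟨C, hC, h⟩ := exists_profile_sub_le (t₀ := 1 / (N : ℝ)) hs hγ
    ⟨by positivity, by rw [div_lt_one] <;> linarith⟩
  refine ⟨C, hC, fun L z x hL => ?_⟩
  have hA := regPower_base_pos hL z x
  have e : ‖x - z‖ ^ 2 / (L ^ 2 + ‖x - z‖ ^ 2) = 1 - L ^ 2 / (L ^ 2 + ‖x - z‖ ^ 2) := by
    field_simp; ring
  have hw : 0 ≤ L ^ 2 / (L ^ 2 + ‖x - z‖ ^ 2) := by positivity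
  have h1 := h (meanCosSq L z x) (by unfold meanCosSq; positivity) (by
    rw [meanCosSq, e]
    exact div_le_div_of_nonneg_right (by linarith) (by linarith))
  have h2 : 1 / (N : ℝ) - meanCosSq L z x ≤ L ^ 2 / (L ^ 2 + ‖x - z‖ ^ 2) := by
    rw [meanCosSq, e, ← sub_div, sub_sub_cancel]
    exact div_le_self hw (by linarith)
  linarith [mul_le_mul_of_nonneg_left h2 hC]

/-- Comparison with a barrier. Regularizing the critical power costs O(w²), w = ℓ/√A, while a term
of exponent γ + 1 contributes a positive amount of order w, which dominates for small w. Near x₀ the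
barrier stays below u by its size. -/
theorem IsViscositySupersolution.exists_regPower_le {s p γ : ℝ} (hN : 2 ≤ N)
    (hs : s ∈ Ioo (0 : ℝ) 1) (hγ : 0 < γ) (hzero : profile s γ (1 / N) = 0)
    (hpos : 0 < profile s (γ + 1) (1 / N))
    {u : EuclideanSpace ℝ (Fin N) → ℝ} (hu : IsViscositySupersolution N s p u)
    {x₀ : EuclideanSpace ℝ (Fin N)} (hx₀ : u x₀ ≠ 0) :
    ∃ c, 0 < c ∧ ∀ x, c * regPower γ 1 0 x ≤ u x := by
  have hN0 : 0 < N := by omega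
  have hNr : (0 : ℝ) < N := by exact_mod_cast hN0
  have hCs := normConst_pos hs
  have hu0 : 0 < u x₀ := lt_of_le_of_ne (hu.nonneg x₀) hx₀.symm
  set m := u x₀ / 2 with hm
  have hm0 : 0 < m := half_pos hu0
  obtain ⟨r, hr, hball⟩ := Metric.eventually_nhds_iff.1
    (hu.lsc x₀ m (half_lt_self hu0))
  obtain ⟨C, hC, hprof⟩ := profile_meanCosSq_ge hN hs hγ
  obtain ⟨C', hC', hprof'⟩ := profile_meanCosSq_ge hN hs (show 0 < γ + 1 by linarith)
  set c₀ := profile s (γ + 1) (1 / N) with hc₀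
  -- With ℓ = r w₀, every y at distance at least r from x₀ has w ≤ w₀, small enough for the term of
  -- order w to win.
  set w₀ := min 1 (c₀ / (4 * (C + C' + 1))) with hw₀
  have hw₀0 : 0 < w₀ := lt_min one_pos (by positivity)
  have hw₀1 : w₀ ≤ 1 := min_le_left _ _
  have hw₀c : 4 * (C + C' + 1) * w₀ ≤ c₀ := by
    have := (le_div_iff₀ (by positivity)).1 (min_le_right 1 (c₀ / (4 * (C + C' + 1))))
    linarith
  set ℓ := r * w₀ with hℓ
  have hℓ0 : 0 < ℓ := mul_pos hr hw₀0
  set a := m * ℓ ^ γ / 2 with ha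
  have hℓγ : 0 < ℓ ^ γ := Real.rpow_pos_of_pos hℓ0 _
  have ha0 : 0 < a := by positivity
  set ψ : EuclideanSpace ℝ (Fin N) → ℝ :=
    fun x => a * regPower γ ℓ x₀ x + (a * ℓ) * regPower (γ + 1) ℓ x₀ x with hψ
  have hψcont : Continuous ψ :=
    ((contDiff_const.mul (contDiff_regPower hℓ0 x₀)).add
      (contDiff_const.mul (contDiff_regPower hℓ0 x₀))).continuous
  have hψm : ∀ x, ψ x ≤ m := by
    intro x
    have h1 := mul_le_mul_of_nonneg_left (regPower_le hγ.le hℓ0 x₀ x) ha0.le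
    have h2 := mul_le_mul_of_nonneg_left (regPower_le (show 0 ≤ γ + 1 by linarith) hℓ0 x₀ x)
      (mul_pos ha0 hℓ0).le
    have e1 : a * ℓ ^ (-γ) = m / 2 := by
      rw [ha, Real.rpow_neg hℓ0.le]; field_simp
    have e2 : a * ℓ * ℓ ^ (-(γ + 1)) = m / 2 := by
      rw [← e1, mul_assoc, ← Real.rpow_one_add' hℓ0.le (by linarith)]; congr 2; ring
    simp only [hψ]; linarith
  have hle : ∀ z, ψ z ≤ u z := by
    by_contra! hcon
    obtain ⟨z, hz⟩ := hcon
    have hlim : Tendsto ψ (cocompact _) (𝓝 0) := by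
      have := ((tendsto_regPower_cocompact (L := ℓ) hγ x₀).const_mul a).add
        ((tendsto_regPower_cocompact (L := ℓ) (show 0 < γ + 1 by linarith) x₀).const_mul (a * ℓ))
      simpa using this
    obtain ⟨K, hK, hKs⟩ := mem_cocompact.1 (hlim.eventually (gt_mem_nhds (sub_pos.2 hz)))
    obtain ⟨y, -, hy⟩ := exists_forall_sub_le hu.lsc hψcont (hK.union isCompact_singleton)
      (z := z) (Or.inr rfl) (fun x hx => by
        have h1 : ψ x < ψ z - u z := hKs fun h => hx (Or.inl h)
        linarith [hu.nonneg x])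
    -- At the touching point u < ψ ≤ m, whereas u > m in the ball of radius r.
    have hyr : r ≤ ‖y - x₀‖ := by
      by_contra! hlt
      have h1 : m < u y := hball (by rwa [dist_eq_norm])
      linarith [hψm y, hy z]
    have ht := hu.touch_regPower hN0 hs ha0.le (mul_pos ha0 hℓ0).le hγ
      (show 0 < γ + 1 by linarith) hℓ0 hℓ0 hy
    have h1 := hprof ℓ x₀ y hℓ0
    have h2 := hprof' ℓ x₀ y hℓ0
    have hA := regPower_base_pos hℓ0 x₀ y
    set A := ℓ ^ 2 + ‖y - x₀‖ ^ 2 with hAd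
    have hsA := Real.sqrt_pos.2 hA
    have hsq : √A ^ 2 = A := Real.sq_sqrt hA.le
    set w := ℓ / √A with hw
    have hw0 : 0 < w := div_pos hℓ0 hsA
    have hww : ℓ ^ 2 / A = w ^ 2 := by rw [hw, div_pow, hsq]
    have hwle : w ≤ w₀ := by
      rw [hw, div_le_iff₀ hsA, hℓ, mul_comm r]
      refine mul_le_mul_of_nonneg_left (Real.le_sqrt_of_sq_le ?_) hw₀0.le
      have := pow_le_pow_left₀ hr.le hyr 2
      nlinarith [sq_nonneg ℓ]
    rw [hww, hzero] at h1
    rw [hww] at h2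
    have hP := Real.rpow_pos_of_pos hA (-γ / 2 - s)
    have hexp : ℓ * A ^ (-(γ + 1) / 2 - s) = A ^ (-γ / 2 - s) * w := by
      have e1 : -(γ + 1) / 2 - s = (-γ / 2 - s) + -(1 / 2) := by ring
      rw [e1, Real.rpow_add hA, Real.rpow_neg hA.le, ← Real.sqrt_eq_rpow, hw]; ring
    have hw1 : w ≤ 1 := hwle.trans hw₀1
    have h4w : 4 * (C + C' + 1) * w ≤ c₀ :=
      (mul_le_mul_of_nonneg_left hwle (by positivity)).trans hw₀c
    have h3 : 0 < profile s γ (meanCosSq ℓ x₀ y) + w * profile s (γ + 1) (meanCosSq ℓ x₀ y) := by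
      have h5 := mul_le_mul_of_nonneg_left h2 hw0.le
      have h6 : 0 < w * (c₀ - C' * w ^ 2 - C * w) := by
        refine mul_pos hw0 ?_
        have : C' * w ^ 2 ≤ C' * w := mul_le_mul_of_nonneg_left
          (by rw [sq]; exact mul_le_of_le_one_left hw0.le hw1) hC'
        linarith [mul_nonneg hC hw0.le, mul_nonneg hC' hw0.le]
      linarith
    have hup : 0 ≤ u y ^ p := Real.rpow_nonneg (hu.nonneg y) p
    have e : a * (A ^ (-γ / 2 - s) * profile s γ (meanCosSq ℓ x₀ y)) +
        a * ℓ * (A ^ (-(γ + 1) / 2 - s) * profile s (γ + 1) (meanCosSq ℓ x₀ y)) =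
        a * A ^ (-γ / 2 - s) *
          (profile s γ (meanCosSq ℓ x₀ y) + w * profile s (γ + 1) (meanCosSq ℓ x₀ y)) := by
      linear_combination (a * profile s (γ + 1) (meanCosSq ℓ x₀ y)) * hexp
    rw [e] at ht
    have : 0 < normConst s * N * (a * A ^ (-γ / 2 - s) *
      (profile s γ (meanCosSq ℓ x₀ y) + w * profile s (γ + 1) (meanCosSq ℓ x₀ y))) := by
      positivity
    linarith
  set D := ℓ ^ 2 + 2 * ‖x₀‖ ^ 2 + 2 with hD
  have hD0 : 0 < D := by positivity
  refine ⟨a * D ^ (-γ / 2), mul_pos ha0 (Real.rpow_pos_of_pos hD0 _), fun x => ?_⟩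
  refine le_trans ?_ (hle x)
  have h1 : D ^ (-γ / 2) * regPower γ 1 0 x ≤ regPower γ ℓ x₀ x := by
    rw [regPower, regPower, ← Real.mul_rpow hD0.le (by positivity)]
    refine Real.rpow_le_rpow_of_nonpos (regPower_base_pos hℓ0 x₀ x) ?_ (by linarith)
    have h2 := norm_sub_le x x₀
    rw [sub_zero]
    have h3 := pow_le_pow_left₀ (norm_nonneg _) h2 2
    nlinarith [sq_nonneg (‖x‖ - ‖x₀‖), mul_nonneg (sq_nonneg ℓ) (sq_nonneg ‖x‖),
      mul_nonneg (sq_nonneg ‖x₀‖) (sq_nonneg ‖x‖)]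
  have h4 : 0 ≤ a * ℓ * regPower (γ + 1) ℓ x₀ x :=
    mul_nonneg (by positivity) (regPower_pos hℓ0 _ _).le
  simp only [hψ]
  rw [mul_assoc]
  linarith [mul_le_mul_of_nonneg_left h1 ha0.le]

/-! ### Nonexistence up to the critical exponent -/

theorem rpow_lower_bound {a b v p : ℝ} (ha : 0 < a) (hav : a ≤ v) (hvb : v ≤ b) :
    min (a ^ p) (b ^ p) ≤ v ^ p := by
  rcases le_total 0 p with h | h
  · exact (min_le_left _ _).trans (Real.rpow_le_rpow ha.le hav h)
  · exact (min_le_right _ _).trans (Real.rpow_le_rpow_of_nonpos (ha.trans_le hav) hvb h)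

theorem regPower_base_comparable {L R : ℝ} {z y : EuclideanSpace ℝ (Fin N)}
    (hR0 : 0 < R) (hR : R ^ 2 = L ^ 2 + ‖z‖ ^ 2) (hy : ‖y - z‖ ≤ R / 2) :
    (R / 2) ^ 2 ≤ L ^ 2 + ‖y‖ ^ 2 ∧ L ^ 2 + ‖y‖ ^ 2 ≤ (2 * R) ^ 2 := by
  have h1 : ‖y‖ ≤ ‖z‖ + R / 2 := by
    have := norm_add_le (y - z) z
    rw [sub_add_cancel] at this; linarith
  have h2 : ‖z‖ - R / 2 ≤ ‖y‖ := by
    have := norm_sub_le y (y - z)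
    rw [sub_sub_cancel] at this; linarith
  have hz := norm_nonneg z
  have hy0 := norm_nonneg y
  have hzR : ‖z‖ ≤ R := (pow_le_pow_iff_left₀ hz hR0.le two_ne_zero).1
    (by linarith [sq_nonneg L])
  constructor
  · rcases le_total ‖z‖ (R / 2) with h | h
    · nlinarith
    · nlinarith [pow_le_pow_left₀ (sub_nonneg.2 h) h2 2]
  · nlinarith [pow_le_pow_left₀ hy0 h1 2]

/-- The main estimate: a supersolution above a multiple `a` of a regularized power, and almost
touching it at `z`. -/
theorem exists_almost_touching_estimate (hN : 2 ≤ N) {s p γ : ℝ} (hs : s ∈ Ioo (0 : ℝ) 1)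
    (hγ : 0 < γ) (hzero : profile s γ (1 / N) = 0) :
    ∃ C, 0 < C ∧ ∀ u : EuclideanSpace ℝ (Fin N) → ℝ, IsViscositySupersolution N s p u →
      ∀ (a L R ε : ℝ) (z : EuclideanSpace ℝ (Fin N)), 0 < a → 0 < L → 0 < ε → ε ≤ 1 → 0 < R →
        R ^ 2 = L ^ 2 + ‖z‖ ^ 2 → (∀ x, a * regPower γ L 0 x ≤ u x) →
        u z < (1 + ε) * (a * R ^ (-γ)) →
        a ^ (p - 1) ≤ C * R ^ (γ * (p - 1) - 2 * s) * (ε + (L / R) ^ 2) := by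
  have hN0 : 0 < N := by omega
  have hNr : (0 : ℝ) < N := by exact_mod_cast hN0
  have hCs := normConst_pos hs
  obtain ⟨C₁, hC₁, hprof⟩ := profile_meanCosSq_ge hN hs hγ
  set P := |profile s 2 0| with hP
  set κ := min ((2 ^ (-γ)) ^ p) ((2 ^ γ + 1 : ℝ) ^ p) with hκ
  have hκ0 : 0 < κ := lt_min (by positivity) (by positivity)
  set C := normConst s * N * (2 ^ (γ + 2 * s) * (4 * C₁) + 5 * P) / κ with hC
  -- The added 1 ensures positivity, as C₁ and P may vanish.
  refine ⟨C + 1, by positivity, fun u hu a L R ε z ha hL hε hε1 hR0 hR hle hz => ?_⟩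
  set T := a * R ^ (-γ) with hT
  have hT0 : 0 < T := mul_pos ha (Real.rpow_pos_of_pos hR0 _)
  -- The bump has height 5εT at z and is at most 4εT beyond distance R/2. As u(z) exceeds the power
  -- by less than εT, the minimum of u - ψ is attained within R/2 of z.
  set B := 5 * ε * T * R ^ 2 with hB
  have hB0 : 0 < B := by positivity
  have hbump : ∀ x, regPower 2 R z x = (R ^ 2 + ‖x - z‖ ^ 2)⁻¹ := fun x => by
    rw [regPower, neg_div, div_self two_ne_zero, Real.rpow_neg_one]
  have hbz : B * regPower 2 R z z = 5 * ε * T := by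
    rw [hbump, sub_self, norm_zero, hB]; field_simp; ring
  have hΦz : a * regPower γ L 0 z = T := by
    rw [regPower, sub_zero, ← hR, sq_rpow_half hR0.le]
  set ψ : EuclideanSpace ℝ (Fin N) → ℝ :=
    fun x => a * regPower γ L 0 x + B * regPower 2 R z x with hψ
  have hψc : Continuous ψ := ((contDiff_const.mul (contDiff_regPower hL 0)).add
      (contDiff_const.mul (contDiff_regPower hR0 z))).continuous
  have hψz : u z - ψ z ≤ -(4 * ε * T) := by
    simp only [hψ]; linarith
  obtain ⟨y, hyK, hy⟩ := exists_forall_sub_le hu.lsc hψc (isCompact_closedBall z (R / 2))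
    (Metric.mem_closedBall_self (by positivity)) fun x hx => by
      have h1 : R / 2 < ‖x - z‖ := by simpa [dist_eq_norm] using hx
      have h2 : B * regPower 2 R z x ≤ 4 * ε * T := by
        rw [hbump, ← div_eq_mul_inv, div_le_iff₀ (by positivity), hB]
        have h3 : R ^ 2 / 4 ≤ ‖x - z‖ ^ 2 := by nlinarith
        have h4 : 0 < ε * T := by positivity
        nlinarith [mul_le_mul_of_nonneg_left h3 h4.le]
      have := hle x
      refine hψz.trans ?_
      simp only [hψ]; linarith
  have hyR : ‖y - z‖ ≤ R / 2 := by simpa [dist_eq_norm] using hyK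
  obtain ⟨hA1, hA2⟩ := regPower_base_comparable hR0 hR hyR
  have hA := regPower_base_pos hL (0 : EuclideanSpace ℝ (Fin N)) y
  have hby : B * regPower 2 R z y ≤ 5 * ε * T := by
    rw [hbump, ← div_eq_mul_inv, div_le_iff₀ (by positivity), hB]
    exact mul_le_mul_of_nonneg_left (by linarith [sq_nonneg ‖y - z‖]) (by positivity)
  have hΦ1 : 2 ^ (-γ) * T ≤ a * regPower γ L 0 y := by
    have h1 : (2 * R) ^ (-γ) ≤ regPower γ L 0 y := by
      rw [regPower, ← sq_rpow_half (by positivity), sub_zero] at *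
      exact Real.rpow_le_rpow_of_nonpos hA hA2 (by linarith)
    rw [Real.mul_rpow zero_le_two hR0.le] at h1
    calc _ = a * (2 ^ (-γ) * R ^ (-γ)) := by rw [hT]; ring
      _ ≤ _ := mul_le_mul_of_nonneg_left h1 ha.le
  have hΦ2 : a * regPower γ L 0 y ≤ 2 ^ γ * T := by
    have h1 : regPower γ L 0 y ≤ (R / 2) ^ (-γ) := by
      rw [regPower, ← sq_rpow_half (by positivity), sub_zero]
      exact Real.rpow_le_rpow_of_nonpos (by positivity) hA1 (by linarith)
    rw [Real.div_rpow hR0.le zero_le_two, Real.rpow_neg zero_le_two, div_inv_eq_mul] at h1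
    calc _ ≤ a * (R ^ (-γ) * 2 ^ γ) := mul_le_mul_of_nonneg_left h1 ha.le
      _ = _ := by rw [hT]; ring
  have hu1 : 2 ^ (-γ) * T ≤ u y := hΦ1.trans (hle y)
  have hu2 : u y ≤ (2 ^ γ + 1) * T := by
    have h1 := (hy z).trans hψz
    simp only [hψ] at h1
    nlinarith [mul_le_of_le_one_left hT0.le hε1]
  -- The sign of p is free, so u(y) is needed within constant factors of T on both sides.
  have hup : κ * T ^ p ≤ u y ^ p := by
    have h1 := rpow_lower_bound (p := p) (v := u y / T) (by positivity)
      ((le_div_iff₀ hT0).2 hu1) ((div_le_iff₀ hT0).2 hu2)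
    rw [Real.div_rpow (hu.nonneg y) hT0.le] at h1
    exact (le_div_iff₀ (Real.rpow_pos_of_pos hT0 _)).1 h1
  have ht := hu.touch_regPower hN0 hs ha.le hB0.le hγ two_pos hL hR0 hy
  have hR2s : 0 < R ^ (-(2 * s)) := Real.rpow_pos_of_pos hR0 _
  -- Since the profile vanishes at 1/N, only the regularization error (L/R)² remains.
  have hfirst : -(2 ^ (γ + 2 * s) * (4 * C₁) * (L / R) ^ 2 * (T * R ^ (-(2 * s)))) ≤
      a * ((L ^ 2 + ‖y - 0‖ ^ 2) ^ (-γ / 2 - s) * profile s γ (meanCosSq L 0 y)) := by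
    have h1 := hprof L 0 y hL
    rw [hzero] at h1
    have h2 : L ^ 2 / (L ^ 2 + ‖y - 0‖ ^ 2) ≤ 4 * (L / R) ^ 2 := by
      rw [sub_zero, div_le_iff₀ (by positivity), div_pow]
      have : L ^ 2 * R ^ 2 ≤ L ^ 2 * (4 * (L ^ 2 + ‖y‖ ^ 2)) :=
        mul_le_mul_of_nonneg_left (by linarith) (sq_nonneg L)
      have h3 : 4 * (L ^ 2 / R ^ 2) * (L ^ 2 + ‖y‖ ^ 2) =
        L ^ 2 * (4 * (L ^ 2 + ‖y‖ ^ 2)) / R ^ 2 := by ring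
      rw [h3, le_div_iff₀ (by positivity)]
      exact this
    have h3 : -(4 * C₁ * (L / R) ^ 2) ≤ profile s γ (meanCosSq L 0 y) := by
      linarith [mul_le_mul_of_nonneg_left h2 hC₁]
    have h4 : (L ^ 2 + ‖y - 0‖ ^ 2) ^ (-γ / 2 - s) ≤ 2 ^ (γ + 2 * s) * (R ^ (-γ) * R ^ (-(2 * s))) := by
      have e : -γ / 2 - s = -(γ + 2 * s) / 2 := by ring
      rw [sub_zero, e]
      refine (Real.rpow_le_rpow_of_nonpos (by positivity) hA1 (by linarith [hs.1])).trans_eq ?_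
      rw [sq_rpow_half (by positivity), Real.div_rpow hR0.le zero_le_two,
        Real.rpow_neg zero_le_two, div_inv_eq_mul, ← Real.rpow_add hR0, mul_comm]
      congr 2; ring
    have h5 := mul_le_mul_of_nonneg_left h3 (Real.rpow_nonneg hA.le (-γ / 2 - s))
    have h6 := mul_le_mul_of_nonneg_right h4 (show 0 ≤ 4 * C₁ * (L / R) ^ 2 by positivity)
    have h7 := mul_le_mul_of_nonneg_left ((neg_le_neg h6).trans ((mul_neg _ _).ge.trans h5)) ha.le
    refine le_trans (le_of_eq ?_) h7
    rw [hT]; ring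
  have hsecond : -(5 * P * ε * (T * R ^ (-(2 * s)))) ≤
      B * ((R ^ 2 + ‖y - z‖ ^ 2) ^ (-2 / 2 - s) * profile s 2 (meanCosSq R z y)) := by
    have h1 : -P ≤ profile s 2 (meanCosSq R z y) := by
      refine (neg_abs_le _).trans (profile_mono hs two_pos le_rfl
        (by unfold meanCosSq; positivity) ?_)
      have hA' := regPower_base_pos hR0 z y
      have hN1 : (1 : ℝ) ≤ N := by exact_mod_cast hN0
      refine (div_le_self (by positivity) hN1).trans_lt ?_
      rw [div_lt_one hA']
      linarith [sq_pos_of_pos hR0]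
    have h2 : (R ^ 2 + ‖y - z‖ ^ 2) ^ (-2 / 2 - s) ≤ (R ^ 2)⁻¹ * R ^ (-(2 * s)) := by
      have e : (-2 / 2 - s : ℝ) = -(2 + 2 * s) / 2 := by ring
      rw [e]
      refine (Real.rpow_le_rpow_of_nonpos (by positivity) (le_add_of_nonneg_right (sq_nonneg _))
        (by linarith [hs.1])).trans_eq ?_
      rw [sq_rpow_half hR0.le, neg_add, Real.rpow_add hR0, Real.rpow_neg hR0.le 2]
      norm_num
    have h3 := mul_le_mul_of_nonneg_left h1 (Real.rpow_nonneg
      (regPower_base_pos hR0 z y).le (-2 / 2 - s))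
    have h4 := mul_le_mul_of_nonneg_right h2 (abs_nonneg (profile s 2 0))
    have h5 := mul_le_mul_of_nonneg_left ((neg_le_neg h4).trans ((mul_neg _ _).ge.trans h3)) hB0.le
    refine le_trans (le_of_eq ?_) h5
    rw [hB, ← hP]; field_simp
  have hmain : κ * T ^ p ≤ normConst s * N * (2 ^ (γ + 2 * s) * (4 * C₁) + 5 * P) *
      (T * R ^ (-(2 * s)) * (ε + (L / R) ^ 2)) := by
    have h1 := mul_le_mul_of_nonneg_left (add_le_add hfirst hsecond)
      (show 0 ≤ normConst s * N by positivity)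
    have h2 : 0 ≤ normConst s * N * (2 ^ (γ + 2 * s) * (4 * C₁) * ε * (T * R ^ (-(2 * s)))) := by
      positivity
    have h3 : 0 ≤ normConst s * N * (5 * P * (L / R) ^ 2 * (T * R ^ (-(2 * s)))) := by
      positivity
    linarith
  have hmain2 : T ^ p ≤ C * (T * R ^ (-(2 * s)) * (ε + (L / R) ^ 2)) := by
    rw [hC, div_mul_eq_mul_div, le_div_iff₀ hκ0]; linarith
  have hTp : T ^ (p - 1) ≤ C * R ^ (-(2 * s)) * (ε + (L / R) ^ 2) := by
    rw [Real.rpow_sub_one hT0.ne', div_le_iff₀ hT0]; linarith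
  have e1 : T ^ (p - 1) = a ^ (p - 1) * R ^ (-(γ * (p - 1))) := by
    rw [hT, Real.mul_rpow ha.le (Real.rpow_nonneg hR0.le _), ← Real.rpow_mul hR0.le]
    congr 2; ring
  have e2 : R ^ (γ * (p - 1) - 2 * s) = R ^ (γ * (p - 1)) * R ^ (-(2 * s)) := by
    rw [← Real.rpow_add hR0]; rfl
  have e3 : R ^ (-(γ * (p - 1))) * R ^ (γ * (p - 1)) = 1 := by
    rw [← Real.rpow_add hR0, neg_add_cancel, Real.rpow_zero]
  have h1 := mul_le_mul_of_nonneg_right hTp (Real.rpow_nonneg hR0.le (γ * (p - 1)))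
  rw [e1, mul_assoc, e3, mul_one] at h1
  refine h1.trans ?_
  rw [e2]
  have h2 : 0 ≤ R ^ (γ * (p - 1)) * R ^ (-(2 * s)) * (ε + (L / R) ^ 2) := by positivity
  linarith

theorem regPower_antitone {γ L₁ L₂ : ℝ} (hγ : 0 ≤ γ) (hL₁ : 0 < L₁) (h : L₁ ≤ L₂)
    (z x : EuclideanSpace ℝ (Fin N)) : regPower γ L₂ z x ≤ regPower γ L₁ z x :=
  Real.rpow_le_rpow_of_nonpos (regPower_base_pos hL₁ z x)
    (by nlinarith [pow_le_pow_left₀ hL₁.le h 2]) (by linarith)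

/-- The largest multiple of `(L² + |x|²)^(-γ/2)` below `u`. -/
noncomputable def bestMultiple (γ : ℝ) (u : EuclideanSpace ℝ (Fin N) → ℝ) (L : ℝ) : ℝ :=
  ⨅ x, u x / regPower γ L 0 x

section bestMultiple

variable {γ L : ℝ} {u : EuclideanSpace ℝ (Fin N) → ℝ}

theorem bddBelow_range_div_regPower (hL : 0 < L) (hu : ∀ x, 0 ≤ u x) :
    BddBelow (range fun x => u x / regPower γ L 0 x) :=
  ⟨0, by rintro _ ⟨x, rfl⟩; exact div_nonneg (hu x) (regPower_pos hL 0 x).le⟩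

theorem bestMultiple_mul_le (hL : 0 < L) (hu : ∀ x, 0 ≤ u x) (x : EuclideanSpace ℝ (Fin N)) :
    bestMultiple γ u L * regPower γ L 0 x ≤ u x :=
  (le_div_iff₀ (regPower_pos hL 0 x)).1 (ciInf_le (bddBelow_range_div_regPower hL hu) x)

theorem le_bestMultiple {a : ℝ} (hL : 0 < L) (h : ∀ x, a * regPower γ L 0 x ≤ u x) :
    a ≤ bestMultiple γ u L :=
  le_ciInf fun x => (le_div_iff₀ (regPower_pos hL 0 x)).2 (h x)

theorem exists_lt_of_bestMultiple_lt {b : ℝ} (hL : 0 < L) (h : bestMultiple γ u L < b) :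
    ∃ z, u z < b * regPower γ L 0 z := by
  obtain ⟨z, hz⟩ := exists_lt_of_ciInf_lt h
  exact ⟨z, (div_lt_iff₀ (regPower_pos hL 0 z)).1 hz⟩

end bestMultiple

theorem IsViscositySupersolution.eq_zero_of_le_critical {s p γ : ℝ} (hN : 2 ≤ N)
    (hs : s ∈ Ioo (0 : ℝ) 1) (hγ : 0 < γ) (hzero : profile s γ (1 / N) = 0)
    (hpos : 0 < profile s (γ + 1) (1 / N)) (hp : γ * (p - 1) ≤ 2 * s)
    {u : EuclideanSpace ℝ (Fin N) → ℝ} (hu : IsViscositySupersolution N s p u) (x₀) :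
    u x₀ = 0 := by
  by_contra hx₀
  obtain ⟨c, hc, hcu⟩ := hu.exists_regPower_le hN hs hγ hzero hpos hx₀
  obtain ⟨C, hC, hest⟩ := exists_almost_touching_estimate (p := p) hN hs hγ hzero
  set q := bestMultiple γ u with hq
  have hq_le : ∀ L, 0 < L → ∀ x, q L * regPower γ L 0 x ≤ u x := fun L hL x =>
    bestMultiple_mul_le hL hu.nonneg x
  have hcq : ∀ L, 1 ≤ L → c ≤ q L := fun L hL => le_bestMultiple (by linarith) fun x =>
    (mul_le_mul_of_nonneg_left (regPower_antitone hγ.le one_pos hL 0 x) hc.le).trans (hcu x)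
  have hval : ∀ L, 0 < L → ∀ z : EuclideanSpace ℝ (Fin N),
      regPower γ L 0 z = √(L ^ 2 + ‖z‖ ^ 2) ^ (-γ) := fun L hL z => by
    rw [← sq_rpow_half (Real.sqrt_nonneg _), Real.sq_sqrt (by positivity), regPower, sub_zero]
  have hRpos : ∀ L, 0 < L → ∀ z : EuclideanSpace ℝ (Fin N), L ≤ √(L ^ 2 + ‖z‖ ^ 2) :=
    fun L hL z => Real.le_sqrt_of_sq_le (by linarith [sq_nonneg ‖z‖])
  -- The estimate with ε = 1: a point where u is below twice the optimal multiple always exists, and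
  -- R ≥ L.
  have hcrude : ∀ L, 1 ≤ L → q L ^ (p - 1) ≤ 2 * C * L ^ (γ * (p - 1) - 2 * s) := by
    intro L hL
    have hL0 : 0 < L := by linarith
    have hq0 : 0 < q L := hc.trans_le (hcq L hL)
    obtain ⟨z, hz⟩ := exists_lt_of_bestMultiple_lt (γ := γ) (u := u) hL0
      (show q L < (1 + 1) * q L by linarith)
    have hR := hRpos L hL0 z
    set R := √(L ^ 2 + ‖z‖ ^ 2) with hRd
    have hR0 : 0 < R := hL0.trans_le hR
    rw [hval L hL0, mul_assoc] at hz
    have h := hest u hu (q L) L R 1 z hq0 hL0 one_pos le_rfl hR0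
      (Real.sq_sqrt (by positivity)) (hq_le L hL0) hz
    have h1 : (L / R) ^ 2 ≤ 1 := by
      rw [div_pow, div_le_one (by positivity)]; exact pow_le_pow_left₀ hL0.le hR 2
    have h2 : R ^ (γ * (p - 1) - 2 * s) ≤ L ^ (γ * (p - 1) - 2 * s) :=
      Real.rpow_le_rpow_of_nonpos hL0 hR (by linarith)
    calc _ ≤ C * R ^ (γ * (p - 1) - 2 * s) * (1 + (L / R) ^ 2) := h
      _ ≤ C * L ^ (γ * (p - 1) - 2 * s) * (1 + 1) := by gcongr
      _ = _ := by ring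
  have hdecay : ∀ r b : ℝ, 0 < r → 0 < b → ∃ L : ℝ, 1 ≤ L ∧ 2 * C * L ^ (-r) < b := by
    intro r b hr hb
    have h1 : Tendsto (fun L : ℝ => 2 * C * L ^ (-r)) atTop (𝓝 0) := by
      simpa using (tendsto_rpow_neg_atTop hr).const_mul (2 * C)
    obtain ⟨L, hL, hLb⟩ := ((eventually_ge_atTop (1 : ℝ)).and (h1.eventually (gt_mem_nhds hb))).exists
    exact ⟨L, hL, hLb⟩
  rcases lt_or_ge p 1 with hp1 | hp1
  -- For p < 1 the power p - 1 reverses inequalities, so an upper bound on q is needed; evaluation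
  -- at the origin gives q(L) ≤ u(0) L^γ.
  · have hu0 : 0 < u 0 := (mul_pos hc (regPower_pos one_pos 0 0)).trans_le (hcu 0)
    obtain ⟨L, hL, hlt⟩ := hdecay (2 * s) (u 0 ^ (p - 1)) (by linarith [hs.1])
      (Real.rpow_pos_of_pos hu0 _)
    have hL0 : 0 < L := by linarith
    have h1 : q L ≤ u 0 * L ^ γ := by
      have := hq_le L hL0 0
      rw [hval L hL0, norm_zero, zero_pow two_ne_zero, add_zero, Real.sqrt_sq hL0.le,
        Real.rpow_neg hL0.le, ← div_eq_mul_inv, div_le_iff₀ (Real.rpow_pos_of_pos hL0 _)] at this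
      exact this
    have h2 := (Real.rpow_le_rpow_of_nonpos (hc.trans_le (hcq L hL)) h1
      (show p - 1 ≤ 0 by linarith)).trans (hcrude L hL)
    rw [Real.mul_rpow hu0.le (Real.rpow_nonneg hL0.le _), ← Real.rpow_mul hL0.le,
      sub_eq_add_neg (γ * (p - 1)), Real.rpow_add hL0] at h2
    have h3 : 0 < L ^ (γ * (p - 1)) := Real.rpow_pos_of_pos hL0 _
    have h4 : u 0 ^ (p - 1) * L ^ (γ * (p - 1)) ≤ 2 * C * L ^ (-(2 * s)) * L ^ (γ * (p - 1)) := by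
      linarith
    linarith [le_of_mul_le_mul_right h4 h3]
  have hcp : 0 < c ^ (p - 1) := Real.rpow_pos_of_pos hc _
  have hlow : ∀ L, 1 ≤ L → c ^ (p - 1) ≤ q L ^ (p - 1) := fun L hL =>
    Real.rpow_le_rpow hc.le (hcq L hL) (by linarith)
  rcases hp.lt_or_eq with hlt | heq
  · obtain ⟨L, hL, hL2⟩ := hdecay (2 * s - γ * (p - 1)) (c ^ (p - 1)) (by linarith) hcp
    rw [neg_sub] at hL2
    linarith [hlow L hL, hcrude L hL]
  have hp1' : 0 < p - 1 := pos_of_mul_pos_right (by rw [heq]; linarith [hs.1]) hγ.le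
  rw [heq, sub_self] at hest hcrude
  simp only [Real.rpow_zero, mul_one] at hest hcrude
  have hbdd : BddAbove (q '' Ici 1) := by
    refine ⟨(2 * C) ^ (1 / (p - 1)), ?_⟩
    rintro _ ⟨L, hL, rfl⟩
    have hq0 := hc.trans_le (hcq L hL)
    have := Real.rpow_le_rpow (Real.rpow_nonneg hq0.le _) (hcrude L hL)
      (show 0 ≤ 1 / (p - 1) by positivity)
    rwa [← Real.rpow_mul hq0.le, mul_one_div_cancel hp1'.ne', Real.rpow_one] at this
  set κ := sSup (q '' Ici 1) with hκ
  have hqκ : ∀ L, 1 ≤ L → q L ≤ κ := fun L hL => le_csSup hbdd ⟨L, hL, rfl⟩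
  have hκ0 : 0 < κ := hc.trans_le ((hcq 1 le_rfl).trans (hqκ 1 le_rfl))
  -- In the critical case L₁ is chosen with q(L₁) nearly the supremum. A point z almost optimal for
  -- a much larger L₂ is then almost optimal for L₁ as well, and the two powers are within a factor
  -- 2 there, which forces z far out on the scale L₁.
  have hfine : ∀ ε, 0 < ε → ε ≤ 1 / 4 → c ^ (p - 1) ≤ C * (5 * ε) := by
    intro ε hε hε4
    obtain ⟨_, ⟨L₁, hL₁, rfl⟩, hκL⟩ := exists_lt_of_lt_csSup (⟨_, mem_image_of_mem q
      (self_mem_Ici (a := (1 : ℝ)))⟩ : (q '' Ici 1).Nonempty)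
      (show (1 - ε) * κ < κ by nlinarith)
    have hL₁' : 1 ≤ L₁ := hL₁
    have hL₁0 : 0 < L₁ := by linarith
    set a := q L₁ with ha
    have ha0 : 0 < a := hc.trans_le (hcq L₁ hL₁)
    set D : ℝ := (2 ^ (1 / γ)) ^ 2 with hD
    have hD0 : 0 < D := by positivity
    -- So large that L₂ ≤ R₂ ≤ 2^(1/γ) R implies (L₁/R)² ≤ ε.
    set L₂ := L₁ * (1 + √(D / ε)) with hL₂
    have hsqD := Real.sq_sqrt (show 0 ≤ D / ε by positivity)
    have hsqD0 := Real.sqrt_nonneg (D / ε)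
    have hL₁₂ : L₁ ≤ L₂ := le_mul_of_one_le_right hL₁0.le (by linarith)
    have hL₂0 : 0 < L₂ := hL₁0.trans_le hL₁₂
    obtain ⟨z, hz⟩ := exists_lt_of_bestMultiple_lt (γ := γ) (u := u) hL₂0
      -- Here q(L₂) ≤ κ < a/(1-ε), and 1 < (1-ε)(1+4ε) for ε ≤ 1/4.
      (show q L₂ < (1 + 4 * ε) * a by
        have h1 := hqκ L₂ (hL₁'.trans hL₁₂)
        have h2 := mul_lt_mul_of_pos_left hκL (show 0 < 1 + 4 * ε by linarith)
        nlinarith [mul_pos hε hκ0])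
    have hlow₁ := hq_le L₁ hL₁0 z
    have hanti := regPower_antitone hγ.le hL₁0 hL₁₂ 0 z
    have hR := hRpos L₁ hL₁0 z
    have hR₂ := hRpos L₂ hL₂0 z
    have hz1 : u z < (1 + 4 * ε) * (a * √(L₁ ^ 2 + ‖z‖ ^ 2) ^ (-γ)) := by
      rw [← hval L₁ hL₁0, ← mul_assoc]
      exact hz.trans_le (mul_le_mul_of_nonneg_left hanti (by positivity))
    have hz2 : √(L₁ ^ 2 + ‖z‖ ^ 2) ^ (-γ) ≤ 2 * √(L₂ ^ 2 + ‖z‖ ^ 2) ^ (-γ) := by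
      rw [← hval L₁ hL₁0, ← hval L₂ hL₂0]
      have h1 := hlow₁.trans hz.le
      have h2 : (1 + 4 * ε) * a * regPower γ L₂ 0 z ≤ a * (2 * regPower γ L₂ 0 z) := by
        have := mul_pos ha0 (regPower_pos (γ := γ) hL₂0 0 z)
        nlinarith
      exact le_of_mul_le_mul_left (h1.trans h2) ha0
    set R := √(L₁ ^ 2 + ‖z‖ ^ 2) with hRd
    set R₂ := √(L₂ ^ 2 + ‖z‖ ^ 2) with hR₂d
    have hR0 : 0 < R := hL₁0.trans_le hR
    have hR₂0 : 0 < R₂ := hL₂0.trans_le hR₂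
    have hRR : R₂ ≤ 2 ^ (1 / γ) * R := by
      rw [Real.rpow_neg hR0.le, Real.rpow_neg hR₂0.le, ← div_eq_mul_inv,
        inv_le_comm₀ (Real.rpow_pos_of_pos hR0 _) (by positivity), inv_div,
        div_le_iff₀ two_pos] at hz2
      have h1 := Real.rpow_le_rpow (Real.rpow_nonneg hR₂0.le _) hz2
        (show 0 ≤ 1 / γ by positivity)
      rw [Real.mul_rpow (Real.rpow_nonneg hR0.le _) zero_le_two, ← Real.rpow_mul hR₂0.le,
        ← Real.rpow_mul hR0.le, mul_one_div_cancel hγ.ne', Real.rpow_one, Real.rpow_one] at h1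
      linarith
    have hratio : (L₁ / R) ^ 2 ≤ ε := by
      have h1 : L₂ ^ 2 ≤ D * R ^ 2 := by
        rw [hD, ← mul_pow]; exact pow_le_pow_left₀ hL₂0.le (hR₂.trans hRR) 2
      have h2 : L₁ ^ 2 * (D / ε) ≤ L₂ ^ 2 := by
        rw [hL₂, mul_pow]
        exact mul_le_mul_of_nonneg_left (by nlinarith) (sq_nonneg _)
      have h3 : L₁ ^ 2 * D ≤ ε * R ^ 2 * D := by
        have := h2.trans h1
        rw [← mul_div_assoc, div_le_iff₀ hε] at this
        linarith
      rw [div_pow, div_le_iff₀ (by positivity)]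
      exact le_of_mul_le_mul_right h3 hD0
    have h := hest u hu a L₁ R (4 * ε) z ha0 hL₁0 (by linarith) (by linarith) hR0
      (Real.sq_sqrt (by positivity)) (hq_le L₁ hL₁0) hz1
    refine (hlow L₁ hL₁).trans (h.trans (mul_le_mul_of_nonneg_left (by linarith) hC.le))
  have h1 := hfine (min (1 / 4) (c ^ (p - 1) / (10 * C))) (lt_min (by norm_num) (by positivity))
    (min_le_left _ _)
  have h2 : C * (5 * min (1 / 4) (c ^ (p - 1) / (10 * C))) ≤ c ^ (p - 1) / 2 := by
    calc _ ≤ C * (5 * (c ^ (p - 1) / (10 * C))) := by gcongr; exact min_le_right _ _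
      _ = _ := by field_simp; ring
  linarith

end

theorem mainTheorem3 (N : ℕ) (hN : 2 ≤ N) (s : ℝ) (hs : s ∈ Set.Ioo (1 / 2 : ℝ) 1) :
    (∀ γ : ℝ, 0 < γ →
      MeasureTheory.IntegrableOn (critIntegrand N s γ) (Set.Ioi (0 : ℝ))) ∧
    ∃ γt : ℝ, 0 < γt ∧
      (∀ γ : ℝ, 0 < γ → γ < γt → critFun N s γ < 0) ∧
      critFun N s γt = 0 ∧
      (∀ γ : ℝ, γt < γ → 0 < critFun N s γ) ∧
      ∀ p : ℝ,
        ((∃ u : EuclideanSpace ℝ (Fin N) → ℝ,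
          IsViscositySupersolution N s p u ∧ ∃ x, u x ≠ 0) ↔ 1 + 2 * s / γt < p) ∧
        ((∃ u : EuclideanSpace ℝ (Fin N) → ℝ,
          IsViscositySupersolution N s p u ∧ LineIntegrable (2 * s) u ∧ ∃ x, u x ≠ 0) ↔
            1 + 2 * s / γt < p) := by
  have hs' : s ∈ Ioo (0 : ℝ) 1 := ⟨by linarith [hs.1], hs.2⟩
  have hN' : (2 : ℝ) ≤ N := by exact_mod_cast hN
  have hNinv : 1 / (N : ℝ) ≤ 1 / 2 := one_div_le_one_div_of_le two_pos hN'
  have hNpos : 0 < 1 / (N : ℝ) := by positivity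
  simp only [critFun_eq, show critIntegrand N s = fun γ => profileIntegrand s γ (1 / N) from
    funext fun γ => funext fun τ => critIntegrand_eq N s γ τ]
  refine ⟨fun γ hγ => integrableOn_profileIntegrand hs' hγ ⟨hNpos.le, by linarith⟩, ?_⟩
  obtain ⟨γt, hγt, hneg, hzero, hpos⟩ := exists_critical_exponent hs' ⟨hNpos, hNinv⟩
  refine ⟨γt, hγt, hneg, hzero, hpos, fun p => ?_⟩
  have hnon : ∀ u : EuclideanSpace ℝ (Fin N) → ℝ, IsViscositySupersolution N s p u →
      (∃ x, u x ≠ 0) → 1 + 2 * s / γt < p := by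
    rintro u hu ⟨x, hx⟩
    by_contra! hp
    refine hx (hu.eq_zero_of_le_critical hN hs' hγt hzero (hpos _ (by linarith)) ?_ x)
    have : p - 1 ≤ 2 * s / γt := by linarith
    rw [le_div_iff₀ hγt] at this
    linarith
  have hex : 1 + 2 * s / γt < p → ∃ u : EuclideanSpace ℝ (Fin N) → ℝ,
      IsViscositySupersolution N s p u ∧ LineIntegrable (2 * s) u ∧ ∃ x, u x ≠ 0 := by
    intro hp
    have h2s : 0 < 2 * s := by linarith [hs'.1]
    have h1 : 2 * s / γt < p - 1 := by linarith
    have hp1 : 0 < p - 1 := (div_pos h2s hγt).trans h1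
    have h2 : 2 * s / (p - 1) < γt := by
      rw [div_lt_iff₀ hγt] at h1
      rw [div_lt_iff₀ hp1]; linarith
    -- The exponent γ = 2s/(p-1) is below γt exactly when p exceeds the critical value.
    exact exists_supersolution hN hs' (div_pos h2s hp1) (div_mul_cancel₀ _ hp1.ne')
      (hneg _ (div_pos h2s hp1) h2)
  exact ⟨⟨fun ⟨u, hu, hx⟩ => hnon u hu hx, fun hp =>
      let ⟨u, hu, _, hx⟩ := hex hp; ⟨u, hu, hx⟩⟩,
    ⟨fun ⟨u, hu, _, hx⟩ => hnon u hu hx, hex⟩⟩
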